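/- **Setting.** Write points of $\mathbb{R}^{N}=\mathbb{R}^{N_1}\times\mathbb{R}^{N_2}$ as $x=(x_1,x_2)$. Let $\Omega\subset\mathbb{R}^{N}$, $R_1\subset\mathbb{R}^{N_1}$ and $R_2\subset\mathbb{R}^{N_2}$ be open and bounded, and put $R=R_1\times R_2$. Let $J,G:\mathbb{R}^N\to\mathbb{R}$ be continuous, nonnegative and integrable, with $J(0)>0$, $J(-x)=J(x)$ for all $x$, and $G\not\equiv 0$. Let $u_0\in H^1(\Omega)$ and $v_0\in L^2(R)$. For $0<\varepsilon\le 1$ consider the rescaled problem $$\begin{cases} \partial_t u^\varepsilon(x,t)=\Delta u^\varepsilon(x,t)+\int_R G(x_1-y_1,\,x_2-\varepsilon y_2)\,(v^\varepsilon(y,t)-u^\varepsilon(x,t))\,dy, & x\in\Omega,\ t>0,\\ \partial_\eta u^\varepsilon(x,t)=0, & x\in\partial\Omega,\ t>0,\\ \partial_t v^\varepsilon(x,t)=\int_R J(x_1-y_1,\,\varepsilon(x_2-y_2))\,(v^\varepsilon(y,t)-v^\varepsilon(x,t))\,dy-\int_\Omega G(x_1-y_1,\,\varepsilon x_2-y_2)\,(v^\varepsilon(x,t)-u^\varepsilon(y,t))\,dy,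 & x\in R,\ t>0,\\ u^\varepsilon(x,0)=u_0(x),\ x\in\Omega,\qquad v^\varepsilon(x,0)=v_0(x),\ x\in R, \end{cases}$$ and the limit problem, in which $|R_2|$ is the Lebesgue measure of $R_2$, $$\begin{cases} \partial_t u^*(x,t)=\Delta u^*(x,t)+\int_{R_1}G(x_1-y_1,\,x_2)\,(V^*(y_1,t)-|R_2|\,u^*(x,t))\,dy_1, & x\in\Omega,\ t>0,\\ \partial_\eta u^*(x,t)=0, & x\in\partial\Omega,\ t>0,\\ \partial_t V^*(x_1,t)=|R_2|\int_{R_1}J(x_1-y_1,0)\,(V^*(y_1,t)-V^*(x_1,t))\,dy_1-\int_\Omega G(x_1-y_1,\,-y_2)\,(V^*(x_1,t)-|R_2|\,u^*(y,t))\,dy, & x_1\in R_1,\ t>0,\\ u^*(x,0)=u_0(x),\ x\in\Omega,\qquad V^*(x_1,0)=\int_{R_2}v_0(x_1,x_2)\,dx_2,\ x_1\in R_1. \end{cases}$$ Thus the limit kernels are $J^*=J(x_1-y_1,0)$ and $G^*=G(x_1-y_1,x_2-0)$ for $x\in\Omega$, respectively $G^*=G(x_1-y_1,0-y_2)$ for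 $y\in\Omega$. Put $S=R$ for the rescaled problem and $S=R_1$ for the limit problem. A solution of either problem is a pair $(u,v)$ with $u\in C([0,\infty);L^2(\Omega))$, $u\in L^2(0,T;H^1(\Omega))$ for every $T>0$, and $v\in C([0,\infty);L^2(S))$, which attains the initial data and satisfies both equations in the weak sense on $[0,T]$ for every $T>0$: they are tested with $\varphi\in C^1([0,T];H^1(\Omega))$ and $\psi\in C^1([0,T];L^2(S))$ respectively, the time derivative is put on the test function, and $\Delta u$ with its Neumann condition is expressed by $-\int_\Omega\nabla u\cdot\nabla\varphi\,dx$. **Theorem.** Let $(u^\varepsilon,v^\varepsilon)$ be a solution of the rescaled problem for each $\varepsilon\in(0,1]$, and let $V^\varepsilon(x_1,t)=\int_{R_2}v^\varepsilon(x_1,x_2,t)\,dx_2$. Then there are $u^*\in C([0,\infty);H^1(\Omega))$, $V^*\in C([0,\infty);L^2(R_1))$ and a function $v^*$ with values in $L^2(R)$, with $V^*(x_1,t)=\int_{R_2}v^*(x_1,x_2,t)\,dx_2$ for all $t\ge0$, such that for every $T>0$, along the whole family as $\varepsilon\to0^+$, $$u^\varepsilon\rightharpoonup u^*\ \text{ in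 } L^\infty(0,T;L^2(\Omega)),\qquad v^\varepsilon\rightharpoonup v^*\ \text{ in } L^\infty(0,T;L^2(R)),\qquad V^\varepsilon\rightharpoonup V^*\ \text{ in } L^\infty(0,T;L^2(R_1)),$$ weakly in these Banach spaces. The pair $(u^*,V^*)$ is a solution of the limit problem, and it is the only one. -/

import Mathlib

open MeasureTheory Set Filter Topology
open scoped ENNReal

noncomputable section

namespace ThinDomain

/-- The Euclidean space `ℝⁿ`. -/
abbrev E (n : ℕ) : Type := EuclideanSpace ℝ (Fin n)

/-- `L²(A)`, the space of (classes of) real square integrable functions on `A`,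
with respect to Lebesgue measure. -/
abbrev L2 {X : Type*} [MeasureSpace X] (A : Set X) : Type _ :=
  Lp ℝ 2 (volume.restrict A)

section Sobolev

variable {N₁ N₂ : ℕ}

/-- Square integrable vector fields on `Ω ⊆ ℝ^{N₁} × ℝ^{N₂}`; the values lie in
`ℝ^{N₁} × ℝ^{N₂}` with its Euclidean norm. -/
abbrev L2Field (Ω : Set (E N₁ × E N₂)) : Type :=
  Lp (WithLp 2 (E N₁ × E N₂)) 2 (volume.restrict Ω)

/-- `g` is the weak gradient of `f` on `Ω`: for every `φ ∈ C_c^∞(Ω)` and every direction `e`,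
`∫_Ω f ∂_e φ = - ∫_Ω (g · e) φ`. -/
def IsWeakGradient (Ω : Set (E N₁ × E N₂)) (f : L2 Ω) (g : L2Field Ω) : Prop :=
  ∀ φ : E N₁ × E N₂ → ℝ, ContDiff ℝ (⊤ : ℕ∞) φ → HasCompactSupport φ → tsupport φ ⊆ Ω →
    ∀ e : E N₁ × E N₂,
      ∫ x in Ω, f x * fderiv ℝ φ x e = - ∫ x in Ω, inner ℝ (g x) (WithLp.toLp 2 e) * φ x

lemma integrable_mul_test {μ : Measure (E N₁ × E N₂)} [IsFiniteMeasureOnCompacts μ]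
    {f ψ : E N₁ × E N₂ → ℝ} (hf : MemLp f 2 μ) (hψ : Continuous ψ) (hc : HasCompactSupport ψ) :
    Integrable (fun x => f x * ψ x) μ :=
  MemLp.integrable_mul (p := 2) (q := 2) hf (hψ.memLp_of_hasCompactSupport hc)

/-- The Sobolev space `H¹(Ω)`, realised as the space of pairs `(f, ∇f)` of an `L²` function having
a square integrable weak gradient and this gradient (which is unique). It carries the norm
`(‖f‖² + ‖∇f‖²)^{1/2}`. -/
def H1 (Ω : Set (E N₁ × E N₂)) : Submodule ℝ (WithLp 2 (L2 Ω × L2Field Ω)) where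
  carrier := {p | IsWeakGradient Ω p.fst p.snd}
  zero_mem' := by
    intro φ _ _ _ e
    have h1 : ∫ x in Ω, (0 : L2 Ω) x * fderiv ℝ φ x e = 0 := by
      refine integral_eq_zero_of_ae ?_
      filter_upwards [Lp.coeFn_zero ℝ 2 (volume.restrict Ω)] with x hx
      rw [hx]; exact zero_mul _
    have h2 : ∫ x in Ω, inner ℝ ((0 : L2Field Ω) x) (WithLp.toLp 2 e) * φ x = 0 := by
      refine integral_eq_zero_of_ae ?_
      filter_upwards [Lp.coeFn_zero (WithLp 2 (E N₁ × E N₂)) 2 (volume.restrict Ω)] with x hx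
      rw [hx, Pi.zero_apply, Pi.zero_apply, inner_zero_left, zero_mul]
    change ∫ x in Ω, (0 : L2 Ω) x * fderiv ℝ φ x e
      = - ∫ x in Ω, inner ℝ ((0 : L2Field Ω) x) (WithLp.toLp 2 e) * φ x
    rw [h1, h2, neg_zero]
  add_mem' := by
    intro p q hp hq φ hφ hc hs e
    have hd : Continuous fun x => fderiv ℝ φ x e :=
      (hφ.continuous_fderiv (by simp)).clm_apply continuous_const
    have hdc : HasCompactSupport fun x => fderiv ℝ φ x e := hc.fderiv_apply ℝ e
    have h1 : ∫ x in Ω, (p.fst + q.fst : L2 Ω) x * fderiv ℝ φ x e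
        = (∫ x in Ω, p.fst x * fderiv ℝ φ x e) + ∫ x in Ω, q.fst x * fderiv ℝ φ x e := by
      rw [← integral_add (integrable_mul_test (Lp.memLp _) hd hdc)
        (integrable_mul_test (Lp.memLp _) hd hdc)]
      refine integral_congr_ae ?_
      filter_upwards [Lp.coeFn_add p.fst q.fst] with x hx
      rw [hx, Pi.add_apply, add_mul]
    have h2 : ∫ x in Ω, inner ℝ ((p.snd + q.snd : L2Field Ω) x) (WithLp.toLp 2 e) * φ x
        = (∫ x in Ω, inner ℝ (p.snd x) (WithLp.toLp 2 e) * φ x)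
          + ∫ x in Ω, inner ℝ (q.snd x) (WithLp.toLp 2 e) * φ x := by
      rw [← integral_add
        (integrable_mul_test ((Lp.memLp p.snd).inner_const (𝕜 := ℝ) _) hφ.continuous hc)
        (integrable_mul_test ((Lp.memLp q.snd).inner_const (𝕜 := ℝ) _) hφ.continuous hc)]
      refine integral_congr_ae ?_
      filter_upwards [Lp.coeFn_add p.snd q.snd] with x hx
      rw [hx, Pi.add_apply, inner_add_left, add_mul]
    change ∫ x in Ω, (p.fst + q.fst : L2 Ω) x * fderiv ℝ φ x e
      = - ∫ x in Ω, inner ℝ ((p.snd + q.snd : L2Field Ω) x) (WithLp.toLp 2 e) * φ x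
    rw [h1, h2, hp φ hφ hc hs e, hq φ hφ hc hs e, neg_add]
  smul_mem' := by
    intro c p hp φ hφ hc hs e
    have h1 : ∫ x in Ω, (c • p.fst : L2 Ω) x * fderiv ℝ φ x e
        = c * ∫ x in Ω, p.fst x * fderiv ℝ φ x e := by
      rw [← integral_const_mul]
      refine integral_congr_ae ?_
      filter_upwards [Lp.coeFn_smul c p.fst] with x hx
      rw [hx, Pi.smul_apply, smul_eq_mul, mul_assoc]
    have h2 : ∫ x in Ω, inner ℝ ((c • p.snd : L2Field Ω) x) (WithLp.toLp 2 e) * φ x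
        = c * ∫ x in Ω, inner ℝ (p.snd x) (WithLp.toLp 2 e) * φ x := by
      rw [← integral_const_mul]
      refine integral_congr_ae ?_
      filter_upwards [Lp.coeFn_smul c p.snd] with x hx
      rw [hx, Pi.smul_apply, real_inner_smul_left, mul_assoc]
    change ∫ x in Ω, (c • p.fst : L2 Ω) x * fderiv ℝ φ x e
      = - ∫ x in Ω, inner ℝ ((c • p.snd : L2Field Ω) x) (WithLp.toLp 2 e) * φ x
    rw [h1, h2, hp φ hφ hc hs e, mul_neg]

/-- The `L²` function underlying an element of `H¹(Ω)`. -/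
def fnOf {Ω : Set (E N₁ × E N₂)} (p : H1 Ω) : L2 Ω := (p : WithLp 2 (L2 Ω × L2Field Ω)).fst

/-- The gradient of an element of `H¹(Ω)`. -/
def gradOf {Ω : Set (E N₁ × E N₂)} (p : H1 Ω) : L2Field Ω :=
  (p : WithLp 2 (L2 Ω × L2Field Ω)).snd

end Sobolev

section Average

variable {N₁ N₂ : ℕ}

lemma sq_integral_le {Y : Type*} [MeasurableSpace Y] (ν : Measure Y) [IsFiniteMeasure ν]
    {f : Y → ℝ} (hf : MemLp f 2 ν) :
    (∫ y, f y ∂ν) ^ 2 ≤ ν.real univ * ∫ y, f y ^ 2 ∂ν := by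
  have hi : Integrable f ν := hf.integrable (by norm_num)
  have hq : Integrable (fun y => f y ^ 2) ν := hf.integrable_sq
  set I := ∫ y, f y ∂ν with hI
  set m := ν.real univ with hm
  have hm0 : 0 ≤ m := measureReal_nonneg
  have key : ∫ y, (m * f y - I) ^ 2 ∂ν = m * (m * (∫ y, f y ^ 2 ∂ν) - I ^ 2) := by
    have : ∀ y, (m * f y - I) ^ 2 = m ^ 2 * f y ^ 2 - 2 * m * I * f y + I ^ 2 := by
      intro y; ring
    simp_rw [this]
    have e1 : Integrable (fun y => m ^ 2 * f y ^ 2) ν := hq.const_mul _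
    have e2 : Integrable (fun y => 2 * m * I * f y) ν := hi.const_mul _
    have e3 : Integrable (fun y => m ^ 2 * f y ^ 2 - 2 * m * I * f y) ν := e1.sub e2
    rw [integral_add e3 (integrable_const _), integral_sub e1 e2, integral_const_mul, integral_const_mul,
      integral_const, smul_eq_mul, ← hI, ← hm]
    ring
  have h0 : 0 ≤ m * (m * (∫ y, f y ^ 2 ∂ν) - I ^ 2) := by
    rw [← key]; exact integral_nonneg fun y => sq_nonneg _
  rcases hm0.eq_or_lt with h | h
  · have hν : ν = 0 := by
      have : ν univ = 0 := by
        rw [hm, eq_comm, measureReal_eq_zero_iff] at h; exact h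
      exact Measure.measure_univ_eq_zero.mp this
    rw [hI, hν]; simp
  · have := nonneg_of_mul_nonneg_right h0 h
    linarith

/-- The integral over the bounded transversal section `R₂` of a function in `L²(R₁ × R₂)` is in
`L²(R₁)`. -/
lemma memLp_transversalIntegral {R₁ : Set (E N₁)} {R₂ : Set (E N₂)}
    (hR₂ : Bornology.IsBounded R₂) (f : L2 (R₁ ×ˢ R₂)) :
    MemLp (fun x₁ => ∫ x₂ in R₂, f (x₁, x₂)) 2 (volume.restrict R₁) := by
  have hfin : IsFiniteMeasure (volume.restrict R₂) :=
    isFiniteMeasure_restrict.mpr hR₂.measure_lt_top.ne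
  have hvol : (volume : Measure (E N₁ × E N₂)).restrict (R₁ ×ˢ R₂)
      = (volume.restrict R₁).prod (volume.restrict R₂) := by
    rw [Measure.volume_eq_prod, Measure.prod_restrict]
  have hf : MemLp f 2 ((volume.restrict R₁).prod (volume.restrict R₂)) := by
    rw [← hvol]; exact Lp.memLp f
  have hsm := hf.1.integral_prod_right'
  rw [memLp_two_iff_integrable_sq hsm]
  have hsq : Integrable (fun z => f z ^ 2) ((volume.restrict R₁).prod (volume.restrict R₂)) :=
    hf.integrable_sq
  refine Integrable.mono' ((hsq.integral_prod_left).const_mul ((volume.restrict R₂).real univ))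
    (hsm.pow 2) ?_
  filter_upwards [hsq.prod_right_ae, hf.1.prodMk_left] with x hx hmx
  rw [Real.norm_of_nonneg (sq_nonneg _)]
  exact sq_integral_le _ ((memLp_two_iff_integrable_sq hmx).mpr hx)

/-- The transversal integral `x₁ ↦ ∫_{R₂} f(x₁, x₂) dx₂` of `f ∈ L²(R₁ × R₂)`, as an element of
`L²(R₁)`. -/
def transversalIntegral {R₁ : Set (E N₁)} {R₂ : Set (E N₂)} (hR₂ : Bornology.IsBounded R₂)
    (f : L2 (R₁ ×ˢ R₂)) : L2 R₁ :=
  (memLp_transversalIntegral hR₂ f).toLp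

end Average

section Solutions

variable {N₁ N₂ : ℕ}

/-- Global weak solutions `(u, v)` of the coupled local/nonlocal system
```
∂u/∂t (x,t) = Δu (x,t) + ∫_S K(x,y) (v(y,t) - c u(x,t)) dy             x ∈ Ω, t > 0
∂u/∂η (x,t) = 0                                                        x ∈ ∂Ω, t > 0
∂v/∂t (x,t) = c ∫_S J(x,y) (v(y,t) - v(x,t)) dy
                 - ∫_Ω K'(x,y) (v(x,t) - c u(y,t)) dy                  x ∈ S, t > 0
u(x,0) = u₀(x),  v(x,0) = v₀(x).
```
The solution lies in `C([0,∞); L²(Ω)) × C([0,∞); L²(S))` with `u ∈ L²(0,T; H¹(Ω))` for all `T`,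
and the equations (with the homogeneous Neumann condition) hold in weak form on `[0,T]` for every
`T > 0`, against all test functions in `C¹(H¹(Ω))` and `C¹(L²(S))`. Here `p t` is the class of
`u t` in `H¹(Ω)`, for almost every `t`. Only times `t ≥ 0` matter. -/
structure IsWeakSolution {Y : Type*} [MeasureSpace Y] (Ω : Set (E N₁ × E N₂)) (S : Set Y) (c : ℝ)
    (J : Y → Y → ℝ) (K : E N₁ × E N₂ → Y → ℝ) (K' : Y → E N₁ × E N₂ → ℝ)
    (u₀ : L2 Ω) (v₀ : L2 S) (u : ℝ → L2 Ω) (v : ℝ → L2 S) : Prop where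
  continuousOn_u : ContinuousOn u (Ici 0)
  continuousOn_v : ContinuousOn v (Ici 0)
  initial_u : u 0 = u₀
  initial_v : v 0 = v₀
  weak_u : ∃ p : ℝ → H1 Ω,
    (∀ T : ℝ, 0 < T → MemLp p 2 (volume.restrict (Ioo 0 T))) ∧
    (∀ᵐ t ∂(volume.restrict (Ioi (0 : ℝ))), fnOf (p t) = u t) ∧
    ∀ T : ℝ, 0 < T → ∀ φ : ℝ → H1 Ω, ContDiff ℝ 1 φ →
      inner ℝ (u T) (fnOf (φ T)) - ∫ t in Ioo 0 T, inner ℝ (u t) (fnOf (deriv φ t))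
        = inner ℝ u₀ (fnOf (φ 0))
          - (∫ t in Ioo 0 T, inner ℝ (gradOf (p t)) (gradOf (φ t)))
          + ∫ t in Ioo 0 T, ∫ x in Ω,
              (∫ y in S, K x y * (v t y - c * u t x)) * fnOf (φ t) x
  weak_v : ∀ T : ℝ, 0 < T → ∀ ψ : ℝ → L2 S, ContDiff ℝ 1 ψ →
      inner ℝ (v T) (ψ T) - ∫ t in Ioo 0 T, inner ℝ (v t) (deriv ψ t)
        = inner ℝ v₀ (ψ 0)
          + (∫ t in Ioo 0 T, ∫ x in S,
              (c * ∫ y in S, J x y * (v t y - v t x)) * ψ t x)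
          - ∫ t in Ioo 0 T, ∫ x in S,
              (∫ y in Ω, K' x y * (v t x - c * u t y)) * ψ t x

/-- Solutions of the rescaled problem on `Ω ∪ R`, `R = R₁ × R₂`, with the kernels
`J_ε(x,y) = J(x₁ - y₁, ε (x₂ - y₂))` for `x, y ∈ R`, `G_ε(x,y) = G(x₁ - y₁, x₂ - ε y₂)` for
`x ∈ Ω`, `y ∈ R`, and `G_ε(x,y) = G(x₁ - y₁, ε x₂ - y₂)` for `x ∈ R`, `y ∈ Ω`. -/
def IsRescaledSolution (J G : E N₁ × E N₂ → ℝ) (Ω : Set (E N₁ × E N₂))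
    (R₁ : Set (E N₁)) (R₂ : Set (E N₂)) (ε : ℝ) (u₀ : L2 Ω) (v₀ : L2 (R₁ ×ˢ R₂))
    (u : ℝ → L2 Ω) (v : ℝ → L2 (R₁ ×ˢ R₂)) : Prop :=
  IsWeakSolution Ω (R₁ ×ˢ R₂) 1
    (fun x y => J (x.1 - y.1, ε • (x.2 - y.2)))
    (fun x y => G (x.1 - y.1, x.2 - ε • y.2))
    (fun x y => G (x.1 - y.1, ε • x.2 - y.2))
    u₀ v₀ u v

/-- Solutions of the limit problem on `Ω ∪ R₁`, with the kernels `J*(x₁,y₁) = J(x₁ - y₁, 0)` for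
`x₁, y₁ ∈ R₁`, `G*(x,y₁) = G(x₁ - y₁, x₂ - 0)` for `x ∈ Ω`, `y₁ ∈ R₁`, and
`G*(x₁,y) = G(x₁ - y₁, 0 - y₂)` for `x₁ ∈ R₁`, `y ∈ Ω`. -/
def IsLimitSolution (J G : E N₁ × E N₂ → ℝ) (Ω : Set (E N₁ × E N₂))
    (R₁ : Set (E N₁)) (R₂ : Set (E N₂)) (u₀ : L2 Ω) (V₀ : L2 R₁)
    (u : ℝ → L2 Ω) (V : ℝ → L2 R₁) : Prop :=
  IsWeakSolution Ω R₁ (volume.real R₂)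
    (fun x₁ y₁ => J (x₁ - y₁, 0))
    (fun x y₁ => G (x.1 - y₁, x.2 - 0))
    (fun x₁ y => G (x₁ - y.1, 0 - y.2))
    u₀ V₀ u V

/-- Weak convergence `f ε ⇀ g` in the Banach space `L^∞(0,T; X)` as `ε → 0⁺`, along the whole
family `0 < ε ≤ 1`: the `f ε` and `g` are in `L^∞(0,T; X)`, and `ℓ (f ε) → ℓ g` for every continuous
linear functional `ℓ` on this space (which contains the predual `L¹(0,T; X')`). -/
def WeaklyConvergesLinfty {X : Type*} [NormedAddCommGroup X] [NormedSpace ℝ X] (T : ℝ)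
    (f : ℝ → ℝ → X) (g : ℝ → X) : Prop :=
  ∃ (F : ℝ → Lp X ∞ (volume.restrict (Ioo 0 T))) (F₀ : Lp X ∞ (volume.restrict (Ioo 0 T))),
    (∀ ε ∈ Ioc (0 : ℝ) 1, F ε =ᵐ[volume.restrict (Ioo 0 T)] f ε) ∧
    F₀ =ᵐ[volume.restrict (Ioo 0 T)] g ∧
    ∀ ℓ : StrongDual ℝ (Lp X ∞ (volume.restrict (Ioo 0 T))),
      Tendsto (fun ε => ℓ (F ε)) (𝓝[>] 0) (𝓝 (ℓ F₀))

end Solutions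

end ThinDomain

end

open ThinDomain

noncomputable section

/-! All problems of the family share the Neumann Laplacian; only the coupling changes with ε, and
the coupling is a bounded operator. Write the system as u' + L u = f, v' = g, (f, g) = A_ε (u, v) on
L²(Ω) × L²(R), where L is the nonnegative operator of the form ∫ ∇p·∇q and A_ε is assembled from
integral operators. Since Ω and R are bounded, the arguments of J and G stay in a compact set, so
the kernels converge uniformly as ε → 0 and A_ε → A_0 in operator norm (`tendsto_exchangeOp`).

An energy estimate and Grönwall's inequality bound the distance of two solutions with the same data
by the distance of their coupling operators (`IsCoupledSolution.dist_sq_le`). The family is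
therefore Cauchy, uniformly on [0,T], and its limit solves the system with A_0
(`exists_limit_coupledSolution`). No compactness and no subsequence enter; the convergence is in
norm, which is more than the weak convergence claimed, and it also supplies the existence of the
limit solution. Uniqueness is the same estimate with equal operators.

At ε = 0 the kernels no longer see the transversal variable of R. Integrating the second equation
over R₂ then gives a closed system for u and V = ∫ v dx₂, which is the limit problem
(`IsCoupledSolution.transversal`); v* itself is the second component of the solution for A_0.

The analytic work lies in a very weak formulation, tested only with fixed elements of the domain of
L (`IsVeryWeakSolution`). Resolvents (1 + L/(n+1))⁻¹ turn it into a differential equation with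
bounded operators, for which energy computations are legitimate. Letting n → ∞ gives the energy
inequality (`IsVeryWeakSolution.energy`) and, when the initial value lies in H¹, continuity with
values in H¹ (`IsVeryWeakSolution.exists_continuousOn_lift`). From that regularity the full weak
formulation is recovered (`IsVeryWeakSolution.weak_form`). -/

namespace ThinDomain

set_option linter.unusedSectionVars false

/-! ### The evolution equation u' + L u = f in a Hilbert space, by resolvents -/

section AbstractEvolution

variable {V H Y : Type*} [NormedAddCommGroup V] [InnerProductSpace ℝ V] [CompleteSpace V]
  [NormedAddCommGroup H] [InnerProductSpace ℝ H] [CompleteSpace H]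
  [NormedAddCommGroup Y] [InnerProductSpace ℝ Y] [CompleteSpace Y]

/-- Pointwise convergence of a bounded sequence of operators extends from a dense set. -/
lemma tendsto_of_tendsto_on_dense {E F : Type*} [NormedAddCommGroup E] [NormedSpace ℝ E]
    [NormedAddCommGroup F] [NormedSpace ℝ F] {A : ℕ → E →L[ℝ] F} {A' : E →L[ℝ] F} {C : ℝ}
    (hC : ∀ n x, ‖A n x - A' x‖ ≤ C * ‖x‖) {D : Set E} (hD : Dense D)
    (h : ∀ x ∈ D, Tendsto (fun n => A n x) atTop (𝓝 (A' x))) (x : E) :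
    Tendsto (fun n => A n x) atTop (𝓝 (A' x)) := by
  rw [Metric.tendsto_atTop]
  intro ε hε
  have hC' : 0 < |C| + 1 := by positivity
  obtain ⟨y, hyD, hy⟩ := hD.exists_dist_lt x (ε := ε / 2 / (|C| + 1)) (by positivity)
  obtain ⟨N, hN⟩ := Metric.tendsto_atTop.mp (h y hyD) (ε / 2) (by positivity)
  refine ⟨N, fun n hn => ?_⟩
  have e : A n x - A' x = (A n (x - y) - A' (x - y)) + (A n y - A' y) := by
    simp only [map_sub]; abel
  rw [dist_eq_norm, e]
  have h1 : ‖A n (x - y) - A' (x - y)‖ ≤ ε / 2 := by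
    refine (hC n (x - y)).trans ?_
    rw [dist_eq_norm, lt_div_iff₀ hC'] at hy
    nlinarith [le_abs_self C, norm_nonneg (x - y)]
  have h2 := hN n hn
  rw [dist_eq_norm] at h2
  exact (norm_add_le _ _).trans_lt (by linarith)

/-- The operator `m (m - 1 + A)⁻¹` associated with the form `⟪p, q⟫`. -/
lemma exists_resolvent (ι : V →L[ℝ] H) {m : ℝ} (hm : 1 ≤ m) :
    ∃ B : H →L[ℝ] V, ∀ y q,
      inner ℝ (B y) q + (m - 1) * inner ℝ (ι (B y)) (ι q) = m * inner ℝ y (ι q) := by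
  let b : V →L[ℝ] V →L[ℝ] ℝ :=
    innerSL ℝ + (m - 1) • ((innerSL ℝ).comp ((ContinuousLinearMap.adjoint ι).comp ι))
  have hb : ∀ p q, b p q = inner ℝ p q + (m - 1) * inner ℝ (ι p) (ι q) := by
    intro p q
    simp only [b, add_apply, smul_apply, ContinuousLinearMap.comp_apply,
      innerSL_apply_apply, ContinuousLinearMap.adjoint_inner_left, smul_eq_mul]
    rfl
  -- Lax–Milgram applies with coercivity constant 1, because m - 1 ≥ 0.
  have hco : IsCoercive b := by
    refine ⟨1, one_pos, fun p => ?_⟩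
    rw [hb, real_inner_self_eq_norm_mul_norm, real_inner_self_eq_norm_mul_norm]
    nlinarith [mul_nonneg (sub_nonneg.mpr hm) (mul_self_nonneg ‖ι p‖)]
  refine ⟨(hco.continuousLinearEquivOfBilin.symm : V →L[ℝ] V).comp
    (m • ContinuousLinearMap.adjoint ι), fun y q => ?_⟩
  rw [← hb, ← hco.continuousLinearEquivOfBilin_apply]
  simp [real_inner_smul_left, ContinuousLinearMap.adjoint_inner_left]

/-- A sequence of resolvents, approximating the identity, of the operator associated with the form
`⟪p, q⟫ - ⟪ι p, ι q⟫`. -/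
structure IsResolventSeq (ι : V →L[ℝ] H) (B : ℕ → H →L[ℝ] V) : Prop where
  form : ∀ n y q, inner ℝ (B n y) q - inner ℝ (ι (B n y)) (ι q)
    = inner ℝ (((n : ℝ) + 1) • (y - ι (B n y))) (ι q)
  norm_le : ∀ n y, ‖ι (B n y)‖ ≤ ‖y‖
  tendsto_id : ∀ y, Tendsto (fun n => ι (B n y)) atTop (𝓝 y)
  tendsto_id' : ∀ w, Tendsto (fun n => B n (ι w)) atTop (𝓝 w)
  norm_le' : ∀ n w, ‖B n (ι w)‖ ≤ 3 * ‖w‖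

/-- With m = n + 1 and L the operator of the form, `ι ∘ B n` is (1 + L/m)⁻¹, and m (y - ι (B n y))
is L applied to `B n y`. Contractivity in `H` is the nonnegativity of the form. Convergence to the
identity is proved on a dense set, the range of `ι` for `H` and the range of its adjoint for `V`,
and extended by uniform boundedness. -/
lemma exists_isResolventSeq (ι : V →L[ℝ] H) (hι : ∀ p, ‖ι p‖ ≤ ‖p‖)
    (hinj : Function.Injective ι) (hd : DenseRange ι) :
    ∃ B : ℕ → H →L[ℝ] V, IsResolventSeq ι B := by
  have hm : ∀ n : ℕ, (1 : ℝ) ≤ n + 1 := fun n => by simp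
  choose B hB using fun n : ℕ => exists_resolvent ι (hm n)
  have hform : ∀ n y q, inner ℝ (B n y) q - inner ℝ (ι (B n y)) (ι q)
      = inner ℝ (((n : ℝ) + 1) • (y - ι (B n y))) (ι q) := by
    intro n y q
    rw [real_inner_smul_left, inner_sub_left]
    linarith [hB n y q]
  have hnorm : ∀ n y, ‖ι (B n y)‖ ≤ ‖y‖ := by
    intro n y
    have h1 := hform n y (B n y)
    rw [real_inner_smul_left, inner_sub_left, real_inner_self_eq_norm_sq,
      real_inner_self_eq_norm_sq] at h1
    have h2 : 0 ≤ ‖B n y‖ ^ 2 - ‖ι (B n y)‖ ^ 2 := by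
      have := hι (B n y)
      have := norm_nonneg (ι (B n y))
      nlinarith
    rw [h1] at h2
    have h3 := nonneg_of_mul_nonneg_right h2 (by positivity)
    have h4 := real_inner_le_norm y (ι (B n y))
    by_contra! hlt
    nlinarith [norm_nonneg y]
  -- the error `e = B n (ι w) - w`
  have herr : ∀ n w, ‖B n (ι w) - w‖ ^ 2 + (n : ℝ) * ‖ι (B n (ι w) - w)‖ ^ 2
      = inner ℝ (ι w) (ι (B n (ι w) - w)) - inner ℝ w (B n (ι w) - w) := by
    intro n w
    set e := B n (ι w) - w with he
    have h1 := hB n (ι w) e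
    have h2 : B n (ι w) = e + w := by rw [he]; abel
    rw [h2, map_add, inner_add_left, inner_add_left, real_inner_self_eq_norm_sq,
      real_inner_self_eq_norm_sq] at h1
    linear_combination h1
  have herr2 : ∀ n w, ‖B n (ι w) - w‖ ≤ 2 * ‖w‖ := by
    intro n w
    have h1 := herr n w
    set e := B n (ι w) - w
    have h2 := real_inner_le_norm (ι w) (ι e)
    have h3 := (abs_le.mp (abs_real_inner_le_norm w e)).1
    have h4 : ‖ι w‖ * ‖ι e‖ ≤ ‖w‖ * ‖e‖ :=
      mul_le_mul (hι w) (hι e) (norm_nonneg _) (norm_nonneg _)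
    have h5 : 0 ≤ (n : ℝ) * ‖ι e‖ ^ 2 := by positivity
    by_contra! hlt
    nlinarith [norm_nonneg w, norm_nonneg e]
  -- In `herr` the right side is bounded by a multiple of ‖w‖², while the left side dominates (n +
  -- 1) ‖ι e‖²; so ‖ι e‖ decays like (n + 1)^(-1/2).
  have herr3 : ∀ w, Tendsto (fun n => ‖ι (B n (ι w) - w)‖) atTop (𝓝 0) := by
    intro w
    have h1 : ∀ n : ℕ, ‖ι (B n (ι w) - w)‖ ^ 2 ≤ (8 * ‖w‖ ^ 2) * (1 / ((n : ℝ) + 1)) := by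
      intro n
      have h1 := herr n w
      have h0 := herr2 n w
      set e := B n (ι w) - w
      have h2 := real_inner_le_norm (ι w) (ι e)
      have h3 := (abs_le.mp (abs_real_inner_le_norm w e)).1
      have h4 : ‖ι w‖ * ‖ι e‖ ≤ ‖w‖ * ‖e‖ :=
        mul_le_mul (hι w) (hι e) (norm_nonneg _) (norm_nonneg _)
      have h5 : ‖ι e‖ ^ 2 ≤ ‖e‖ ^ 2 := pow_le_pow_left₀ (norm_nonneg _) (hι e) 2
      rw [mul_one_div, le_div_iff₀ (by positivity)]
      nlinarith [norm_nonneg w, norm_nonneg e]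
    have h2 : Tendsto (fun n => ‖ι (B n (ι w) - w)‖ ^ 2) atTop (𝓝 0) := by
      refine squeeze_zero (fun n => by positivity) h1 ?_
      simpa only [mul_zero] using
        (tendsto_one_div_add_atTop_nhds_zero_nat (𝕜 := ℝ)).const_mul (8 * ‖w‖ ^ 2)
    simpa [Real.sqrt_sq] using h2.sqrt
  have hidH : ∀ y, Tendsto (fun n => ι (B n y)) atTop (𝓝 y) := by
    refine tendsto_of_tendsto_on_dense (A := fun n => ι.comp (B n))
      (A' := ContinuousLinearMap.id ℝ H) (C := 2) (D := range ι) ?_ hd ?_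
    · intro n x
      have := hnorm n x
      have := norm_sub_le (ι (B n x)) x
      simp only [ContinuousLinearMap.comp_apply, ContinuousLinearMap.id_apply]
      linarith
    · rintro _ ⟨w, rfl⟩
      rw [tendsto_iff_norm_sub_tendsto_zero]
      simpa using herr3 w
  -- The orthogonal complement of the range of the adjoint is the kernel of `ι`, which is trivial.
  have hdense : Dense (range (ContinuousLinearMap.adjoint ι)) := by
    have : (LinearMap.range
        (ContinuousLinearMap.adjoint ι).toLinearMap).topologicalClosure = ⊤ := by
      rw [Submodule.topologicalClosure_eq_top_iff]
      rw [Submodule.eq_bot_iff]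
      intro x hx
      rw [Submodule.mem_orthogonal] at hx
      apply hinj
      rw [map_zero]
      have := hx _ ⟨ι x, rfl⟩
      rw [ContinuousLinearMap.coe_coe, ContinuousLinearMap.adjoint_inner_left] at this
      exact inner_self_eq_zero.mp this
    have h2 := Submodule.dense_iff_topologicalClosure_eq_top.mpr this
    rwa [LinearMap.coe_range] at h2
  refine ⟨B, hform, hnorm, hidH, ?_, ?_⟩
  · refine tendsto_of_tendsto_on_dense (A := fun n => (B n).comp ι)
      (A' := ContinuousLinearMap.id ℝ V) (C := 2) ?_ hdense ?_
    · intro n x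
      exact herr2 n x
    · rintro _ ⟨z, rfl⟩
      set w := ContinuousLinearMap.adjoint ι z
      rw [tendsto_iff_norm_sub_tendsto_zero]
      simp only [ContinuousLinearMap.comp_apply, ContinuousLinearMap.id_apply]
      have h1 : ∀ n, ‖B n (ι w) - w‖ ^ 2 ≤ (‖ι w‖ + ‖z‖) * ‖ι (B n (ι w) - w)‖ := by
        intro n
        have h1 := herr n w
        set e := B n (ι w) - w
        -- For w in the range of the adjoint the `V` product with e only sees ι e, so smallness of e
        -- in `H` upgrades to smallness in `V`.
        have h2 : inner ℝ w e = inner ℝ z (ι e) := ContinuousLinearMap.adjoint_inner_left _ _ _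
        rw [h2] at h1
        have h3 := real_inner_le_norm (ι w) (ι e)
        have h4 := (abs_le.mp (abs_real_inner_le_norm z (ι e))).1
        have h5 : 0 ≤ (n : ℝ) * ‖ι e‖ ^ 2 := by positivity
        nlinarith
      have h2 : Tendsto (fun n => ‖B n (ι w) - w‖ ^ 2) atTop (𝓝 0) := by
        refine squeeze_zero (fun n => by positivity) h1 ?_
        simpa using (herr3 w).const_mul (‖ι w‖ + ‖z‖)
      simpa [Real.sqrt_sq] using h2.sqrt
  · intro n w
    have h1 := herr2 n w
    have h2 := norm_add_le (B n (ι w) - w) w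
    rw [sub_add_cancel] at h2
    linarith

/-- Solutions of `u' + L u = f`, `u 0 = u₀`, where `L` is the operator on `H` associated with the
form `⟪p, q⟫ - ⟪ι p, ι q⟫` on `V`, tested with elements `w` of the domain of `L`, `z = L w`. -/
def IsVeryWeakSolution (ι : V →L[ℝ] H) (u₀ : H) (u f : ℝ → H) : Prop :=
  ∀ w z, (∀ q, inner ℝ w q - inner ℝ (ι w) (ι q) = inner ℝ z (ι q)) → ∀ t, 0 ≤ t →
    inner ℝ (u t) (ι w) = inner ℝ u₀ (ι w) + ∫ s in (0)..t, (inner ℝ (f s) (ι w) - inner ℝ (u s) z)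

lemma IsVeryWeakSolution.sub {ι : V →L[ℝ] H} {u₀ u₀' : H} {u f u' f' : ℝ → H}
    (h : IsVeryWeakSolution ι u₀ u f) (h' : IsVeryWeakSolution ι u₀' u' f')
    (hu : Continuous u) (hf : Continuous f) (hu' : Continuous u') (hf' : Continuous f') :
    IsVeryWeakSolution ι (u₀ - u₀') (fun t => u t - u' t) (fun t => f t - f' t) := by
  intro w z hwz t ht
  have e : ∀ s, inner ℝ (f s - f' s) (ι w) - inner ℝ (u s - u' s) z
      = (inner ℝ (f s) (ι w) - inner ℝ (u s) z) - (inner ℝ (f' s) (ι w) - inner ℝ (u' s) z) := by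
    intro s; simp only [inner_sub_left]; ring
  simp only [e]
  rw [intervalIntegral.integral_sub, inner_sub_left, inner_sub_left, h w z hwz t ht,
    h' w z hwz t ht]
  · ring
  · exact Continuous.intervalIntegrable (by fun_prop) _ _
  · exact Continuous.intervalIntegrable (by fun_prop) _ _

/-- The form is symmetric, so its resolvents are self-adjoint: insert each resolvent as the test
element of the other. -/
lemma IsResolventSeq.inner_symm {ι : V →L[ℝ] H} {B : ℕ → H →L[ℝ] V} (hB : IsResolventSeq ι B)
    (n : ℕ) (x y : H) : inner ℝ (ι (B n x)) y = inner ℝ x (ι (B n y)) := by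
  have h1 := hB.form n x (B n y)
  have h2 := hB.form n y (B n x)
  rw [real_inner_comm, real_inner_comm (ι (B n y)), h2] at h1
  rw [real_inner_smul_left, real_inner_smul_left, inner_sub_left, inner_sub_left] at h1
  have h3 := mul_left_cancel₀ (by positivity : (n : ℝ) + 1 ≠ 0) h1
  have h4 := real_inner_comm (ι (B n x)) y
  have h5 := real_inner_comm (ι (B n x)) (ι (B n y))
  linarith

/-- `B n y` is an admissible test element for every y, with L (B n y) = (n + 1)(y - ι (B n y)).
Moving the resolvent onto u by self-adjointness gives an integral equation in `H` in which L is
replaced by a bounded operator, so the regularized solution is differentiable in time. -/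
lemma IsVeryWeakSolution.resolvent {ι : V →L[ℝ] H} {B : ℕ → H →L[ℝ] V} (hB : IsResolventSeq ι B)
    {u₀ : H} {u f : ℝ → H} (h : IsVeryWeakSolution ι u₀ u f) (hu : Continuous u)
    (hf : Continuous f) (n : ℕ) {t : ℝ} (ht : 0 ≤ t) :
    ι (B n (u t)) = ι (B n u₀)
      + ∫ s in (0)..t, (ι (B n (f s)) - ((n : ℝ) + 1) • (u s - ι (B n (u s)))) := by
  refine ext_inner_right ℝ fun y => ?_
  have hi : IntervalIntegrable
      (fun s => ι (B n (f s)) - ((n : ℝ) + 1) • (u s - ι (B n (u s)))) volume 0 t :=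
    Continuous.intervalIntegrable (by fun_prop) _ _
  rw [inner_add_left, real_inner_comm y (intervalIntegral _ _ _ _), ← innerSL_apply_apply ℝ y,
    ← ContinuousLinearMap.intervalIntegral_comp_comm _ hi, hB.inner_symm, hB.inner_symm,
    h _ _ (hB.form n y) t ht]
  congr 1
  refine intervalIntegral.integral_congr fun s _ => ?_
  simp only [innerSL_apply_apply, inner_sub_right, real_inner_smul_right]
  rw [real_inner_comm _ y, hB.inner_symm, real_inner_comm (ι (B n (u s))) y, hB.inner_symm,
    real_inner_comm (u s) y]

lemma hasDerivAt_const_add_integral {E : Type*} [NormedAddCommGroup E] [NormedSpace ℝ E]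
    [CompleteSpace E] (x : E) {h : ℝ → E} (hh : Continuous h) (t : ℝ) :
    HasDerivAt (fun t => x + ∫ s in (0)..t, h s) (h t) t :=
  ((hh.integral_hasStrictDerivAt 0 t).hasDerivAt).const_add x

lemma norm_sq_const_add_integral (x : H) {h : ℝ → H} (hh : Continuous h) (t : ℝ) :
    ‖x + ∫ s in (0)..t, h s‖ ^ 2
      = ‖x‖ ^ 2 + ∫ s in (0)..t, 2 * inner ℝ (x + ∫ r in (0)..s, h r) (h s) := by
  have hd := hasDerivAt_const_add_integral x hh
  have hc : Continuous (fun t => x + ∫ s in (0)..t, h s) :=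
    continuous_iff_continuousAt.mpr fun t => (hd t).continuousAt
  have := intervalIntegral.integral_eq_sub_of_hasDerivAt (a := 0) (b := t)
    (fun s _ => (hd s).norm_sq)
    (Continuous.intervalIntegrable (by fun_prop) _ _)
  rw [this]
  simp

lemma IsResolventSeq.inner_nonneg {ι : V →L[ℝ] H} {B : ℕ → H →L[ℝ] V} (hB : IsResolventSeq ι B)
    (hι : ∀ p, ‖ι p‖ ≤ ‖p‖) (n : ℕ) (y : H) :
    0 ≤ inner ℝ (ι (B n y)) (((n : ℝ) + 1) • (y - ι (B n y))) := by
  rw [real_inner_comm, ← hB.form, real_inner_self_eq_norm_sq, real_inner_self_eq_norm_sq]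
  have := pow_le_pow_left₀ (norm_nonneg _) (hι (B n y)) 2
  linarith

/-- The energy inequality. -/
lemma IsVeryWeakSolution.energy {ι : V →L[ℝ] H} (hι : ∀ p, ‖ι p‖ ≤ ‖p‖)
    (hinj : Function.Injective ι) (hd : DenseRange ι)
    {u₀ : H} {u f : ℝ → H} (h : IsVeryWeakSolution ι u₀ u f) (hu : Continuous u)
    (hf : Continuous f) {t : ℝ} (ht : 0 ≤ t) :
    ‖u t‖ ^ 2 ≤ ‖u₀‖ ^ 2 + ∫ s in (0)..t, 2 * inner ℝ (u s) (f s) := by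
  obtain ⟨B, hB⟩ := exists_isResolventSeq ι hι hinj hd
  have hn : ∀ n, ‖ι (B n (u t))‖ ^ 2
      ≤ ‖ι (B n u₀)‖ ^ 2 + ∫ s in (0)..t, 2 * inner ℝ (ι (B n (u s))) (ι (B n (f s))) := by
    intro n
    set h' : ℝ → H := fun s => ι (B n (f s)) - ((n : ℝ) + 1) • (u s - ι (B n (u s))) with hh'
    have hc : Continuous h' := by fun_prop
    have heq : ∀ s, 0 ≤ s → ι (B n (u s)) = ι (B n u₀) + ∫ r in (0)..s, h' r :=
      fun s hs => h.resolvent hB hu hf n hs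
    rw [heq t ht, norm_sq_const_add_integral _ hc]
    have hcont : Continuous (fun t => ι (B n u₀) + ∫ s in (0)..t, h' s) :=
      continuous_iff_continuousAt.mpr
        fun t => (hasDerivAt_const_add_integral _ hc t).continuousAt
    -- The discarded term is the product of the regularized solution with its image under L, which
    -- is nonnegative.
    have hmono : ∫ s in (0)..t, 2 * inner ℝ (ι (B n u₀) + ∫ r in (0)..s, h' r) (h' s)
        ≤ ∫ s in (0)..t, 2 * inner ℝ (ι (B n (u s))) (ι (B n (f s))) := by
      refine intervalIntegral.integral_mono_on ht
        (Continuous.intervalIntegrable (by fun_prop) _ _)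
        (Continuous.intervalIntegrable (by fun_prop) _ _) fun s hs => ?_
      rw [← heq s hs.1, hh', inner_sub_right]
      have := hB.inner_nonneg hι n (u s)
      linarith
    linarith
  have hT : ∀ x, Tendsto (fun n => ‖ι (B n x)‖ ^ 2) atTop (𝓝 (‖x‖ ^ 2)) :=
    fun x => ((hB.tendsto_id x).norm).pow 2
  refine le_of_tendsto_of_tendsto' (hT (u t)) ((hT u₀).add ?_) hn
  refine intervalIntegral.tendsto_integral_filter_of_dominated_convergence
    (fun s => 2 * (‖u s‖ * ‖f s‖)) ?_ ?_ ?_ ?_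
  · exact Eventually.of_forall fun n => Continuous.aestronglyMeasurable (by fun_prop)
  · refine Eventually.of_forall fun n => Eventually.of_forall fun s _ => ?_
    rw [norm_mul, Real.norm_ofNat]
    gcongr
    exact (norm_inner_le_norm _ _).trans
      (mul_le_mul (hB.norm_le n _) (hB.norm_le n _) (norm_nonneg _) (norm_nonneg _))
  · exact Continuous.intervalIntegrable (by fun_prop) _ _
  · exact Eventually.of_forall fun s _ =>
      ((hB.tendsto_id (u s)).inner (hB.tendsto_id (f s))).const_mul 2

/-- The integrand is the price, in the `V` energy estimate of `exists_continuousOn_lift`, of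
replacing f by its image under two resolvents. It is dominated since resolvents are contractions. -/
lemma tendsto_integral_resolvent_error {ι : V →L[ℝ] H} {B : ℕ → H →L[ℝ] V}
    (hB : IsResolventSeq ι B) {u f : ℝ → H} (hu : Continuous u) (hf : Continuous f) (T : ℝ) :
    Tendsto (fun n => ∫ s in (0)..T, (‖ι (B n (ι (B n (f s)))) - f s‖ ^ 2
      + 4 * (‖u s‖ * ‖ι (B n (ι (B n (f s)))) - f s‖))) atTop (𝓝 0) := by
  have hle : ∀ n y, ‖ι (B n (ι (B n y))) - y‖ ≤ 2 * ‖ι (B n y) - y‖ := by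
    intro n y
    have e : ι (B n (ι (B n y))) - y = ι (B n (ι (B n y) - y)) + (ι (B n y) - y) := by
      simp only [map_sub]; abel
    rw [e, two_mul]
    exact (norm_add_le _ _).trans (add_le_add_left (hB.norm_le _ _) _)
  have hle2 : ∀ n y, ‖ι (B n (ι (B n y))) - y‖ ≤ 2 * ‖y‖ := by
    intro n y
    have h1 := norm_sub_le (ι (B n (ι (B n y)))) y
    have h2 := hB.norm_le n (ι (B n y))
    have h3 := hB.norm_le n y
    linarith
  have hz : ∀ y, Tendsto (fun n => ‖ι (B n (ι (B n y))) - y‖) atTop (𝓝 0) := by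
    intro y
    refine squeeze_zero (fun n => norm_nonneg _) (fun n => hle n y) ?_
    simpa using ((tendsto_iff_norm_sub_tendsto_zero.mp (hB.tendsto_id y))).const_mul 2
  suffices h : Tendsto (fun n => ∫ s in (0)..T, (‖ι (B n (ι (B n (f s)))) - f s‖ ^ 2
      + 4 * (‖u s‖ * ‖ι (B n (ι (B n (f s)))) - f s‖))) atTop
      (𝓝 (∫ s in (0 : ℝ)..T, (0 : ℝ))) by rwa [intervalIntegral.integral_zero] at h
  refine intervalIntegral.tendsto_integral_filter_of_dominated_convergence
    (fun s => (2 * ‖f s‖) ^ 2 + 4 * (‖u s‖ * (2 * ‖f s‖))) ?_ ?_ ?_ ?_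
  · exact Eventually.of_forall fun n => Continuous.aestronglyMeasurable (by fun_prop)
  · refine Eventually.of_forall fun n => Eventually.of_forall fun s _ => ?_
    rw [Real.norm_of_nonneg (by positivity)]
    gcongr
    · exact hle2 _ _
    · exact hle2 _ _
  · exact Continuous.intervalIntegrable (by fun_prop) _ _
  · refine Eventually.of_forall fun s _ => ?_
    have := ((hz (f s)).pow 2).add (((hz (f s)).const_mul ‖u s‖).const_mul 4)
    simpa using this

/-- Continuity in `V` of the solution with initial value in `V`. -/
lemma IsVeryWeakSolution.exists_continuousOn_lift {ι : V →L[ℝ] H} (hι : ∀ p, ‖ι p‖ ≤ ‖p‖)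
    (hinj : Function.Injective ι) (hd : DenseRange ι)
    {w₀ : V} {u f : ℝ → H} (h : IsVeryWeakSolution ι (ι w₀) u f) (hu : Continuous u)
    (hf : Continuous f) :
    ∃ p : ℝ → V, ContinuousOn p (Ici 0) ∧ ∀ t, 0 ≤ t → ι (p t) = u t := by
  obtain ⟨B, hB⟩ := exists_isResolventSeq ι hι hinj hd
  set ρ : ℕ → ℝ → ℝ := fun n s => ‖ι (B n (ι (B n (f s)))) - f s‖ ^ 2
      + 4 * (‖u s‖ * ‖ι (B n (ι (B n (f s)))) - f s‖) with hρ
  have hρc : ∀ n, Continuous (ρ n) := fun n => by fun_prop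
  -- Two resolvents are applied: the first makes the curve differentiable in `H`, the second carries
  -- its derivative into `V`.
  set D : ℕ → ℝ → V := fun n t => B n (ι (B n (u t))) with hD
  set β : ℝ → ℕ → ℝ := fun T n => 2 * ‖B n (ι (B n (ι w₀))) - w₀‖ ^ 2 + ∫ s in (0)..T, ρ n s
    with hβ
  -- Energy estimate in the norm of `V` for d = D n - D k. With ℓ = L d and r = rn - rk, the
  -- derivative of d is r - ℓ in `H`, so ⟪d, d'⟫ in `V` equals ⟪ι d, r⟫ - ⟪ι d, ℓ⟫ + ⟪ℓ, r⟫ - ‖ℓ‖².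
  -- The second term is -⟪L d, ι d⟫ ≤ 0.
  have hkey : ∀ T n k t, t ∈ Icc 0 T → ‖D n t - D k t‖ ^ 2 ≤ β T n + β T k := by
    intro T n k t ht
    set g : ℕ → ℝ → H := fun n s =>
      ι (B n (f s)) - ((n : ℝ) + 1) • (u s - ι (B n (u s))) with hg
    have hgc : ∀ n, Continuous (g n) := fun n => by fun_prop
    have hD' : ∀ n s, 0 ≤ s →
        D n s = B n (ι (B n (ι w₀))) + ∫ r in (0)..s, B n (g n r) := by
      intro n s hs
      have := (B n).intervalIntegral_comp_comm ((hgc n).intervalIntegrable (μ := volume) 0 s)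
      rw [this, ← map_add, ← h.resolvent hB hu hf n hs]
    set x := B n (ι (B n (ι w₀))) - B k (ι (B k (ι w₀))) with hx
    set h' : ℝ → V := fun s => B n (g n s) - B k (g k s) with hh'
    have hh'c : Continuous h' := by fun_prop
    have hdiff : ∀ s, 0 ≤ s → D n s - D k s = x + ∫ r in (0)..s, h' r := by
      intro s hs
      rw [hD' n s hs, hD' k s hs, hh', intervalIntegral.integral_sub, hx]
      · abel
      · exact Continuous.intervalIntegrable (by fun_prop) _ _
      · exact Continuous.intervalIntegrable (by fun_prop) _ _
    rw [hdiff t ht.1, norm_sq_const_add_integral x hh'c]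
    have hcont : Continuous (fun t => x + ∫ s in (0)..t, h' s) :=
      continuous_iff_continuousAt.mpr
        fun t => (hasDerivAt_const_add_integral _ hh'c t).continuousAt
    have hint : ∫ s in (0)..t, 2 * inner ℝ (x + ∫ r in (0)..s, h' r) (h' s)
        ≤ ∫ s in (0)..t, (ρ n s + ρ k s) := by
      refine intervalIntegral.integral_mono_on ht.1
        (Continuous.intervalIntegrable (by fun_prop) _ _)
        (Continuous.intervalIntegrable (by fun_prop) _ _) fun s hs => ?_
      rw [← hdiff s hs.1]
      set d := D n s - D k s with hdd
      set ℓ : H := ((n : ℝ) + 1) • (ι (B n (u s)) - ι (B n (ι (B n (u s)))))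
        - ((k : ℝ) + 1) • (ι (B k (u s)) - ι (B k (ι (B k (u s))))) with hℓ
      set rn := ι (B n (ι (B n (f s)))) - f s with hrn
      set rk := ι (B k (ι (B k (f s)))) - f s with hrk
      have hform : ∀ q, inner ℝ d q - inner ℝ (ι d) (ι q) = inner ℝ ℓ (ι q) := by
        intro q
        have a := hB.form n (ι (B n (u s))) q
        have b := hB.form k (ι (B k (u s))) q
        have e : inner ℝ ℓ (ι q) = _ := inner_sub_left _ _ _
        rw [e, ← a, ← b, hdd, map_sub, inner_sub_left, inner_sub_left]
        simp only [hD]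
        ring
      have hιh : ι (h' s) = (rn - rk) - ℓ := by
        simp only [hh', hg, hrn, hrk, hℓ, map_sub, map_smul, smul_sub]
        abel
      have h1 := hform (h' s)
      have h2 := hform d
      rw [hιh, inner_sub_right (ι d), inner_sub_right ℓ (rn - rk), real_inner_self_eq_norm_sq] at h1
      rw [real_inner_self_eq_norm_sq, real_inner_self_eq_norm_sq, real_inner_comm] at h2
      have h3 := pow_le_pow_left₀ (norm_nonneg _) (hι d) 2
      have h4 := real_inner_le_norm ℓ (rn - rk)
      have h5 := real_inner_le_norm (ι d) (rn - rk)
      have h6 : ‖ι d‖ ≤ 2 * ‖u s‖ := by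
        rw [hdd, map_sub]
        have a1 := norm_sub_le (ι (D n s)) (ι (D k s))
        have a2 := (hB.norm_le n (ι (B n (u s)))).trans (hB.norm_le n (u s))
        have a3 := (hB.norm_le k (ι (B k (u s)))).trans (hB.norm_le k (u s))
        linarith
      have h7 := norm_sub_le rn rk
      have h8 : ‖rn - rk‖ ^ 2 ≤ 2 * (‖rn‖ ^ 2 + ‖rk‖ ^ 2) := by
        have := pow_le_pow_left₀ (norm_nonneg _) h7 2
        nlinarith [sq_nonneg (‖rn‖ - ‖rk‖)]
      have h9 : ‖ι d‖ * ‖rn - rk‖ ≤ 2 * ‖u s‖ * (‖rn‖ + ‖rk‖) :=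
        mul_le_mul h6 h7 (norm_nonneg _) (by positivity)
      -- Young's inequality: ‖ℓ‖ ‖r‖ ≤ ‖ℓ‖² + ‖r‖²/4, so that -‖ℓ‖² absorbs the only term in which ℓ
      -- is not controlled.
      have h10 : 0 ≤ (2 * ‖ℓ‖ - ‖rn - rk‖) ^ 2 := sq_nonneg _
      change 2 * inner ℝ d (h' s) ≤ (‖rn‖ ^ 2 + 4 * (‖u s‖ * ‖rn‖))
        + (‖rk‖ ^ 2 + 4 * (‖u s‖ * ‖rk‖))
      nlinarith
    have hint2 : ∫ s in (0)..t, (ρ n s + ρ k s) ≤ ∫ s in (0)..T, (ρ n s + ρ k s) := by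
      refine intervalIntegral.integral_mono_interval le_rfl ht.1 ht.2 ?_
        (Continuous.intervalIntegrable (by fun_prop) _ _)
      refine Eventually.of_forall fun s => ?_
      simp only [hρ, Pi.zero_apply]
      positivity
    rw [intervalIntegral.integral_add ((hρc n).intervalIntegrable _ _)
      ((hρc k).intervalIntegrable _ _), intervalIntegral.integral_add
      ((hρc n).intervalIntegrable _ _) ((hρc k).intervalIntegrable _ _)] at hint2
    rw [intervalIntegral.integral_add ((hρc n).intervalIntegrable _ _)
      ((hρc k).intervalIntegrable _ _)] at hint
    have hx2 : ‖x‖ ^ 2 ≤ 2 * ‖B n (ι (B n (ι w₀))) - w₀‖ ^ 2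
        + 2 * ‖B k (ι (B k (ι w₀))) - w₀‖ ^ 2 := by
      have e : x = (B n (ι (B n (ι w₀))) - w₀) - (B k (ι (B k (ι w₀))) - w₀) := by
        rw [hx]; abel
      have a := norm_sub_le (B n (ι (B n (ι w₀))) - w₀) (B k (ι (B k (ι w₀))) - w₀)
      rw [← e] at a
      have := pow_le_pow_left₀ (norm_nonneg _) a 2
      nlinarith [sq_nonneg (‖B n (ι (B n (ι w₀))) - w₀‖ - ‖B k (ι (B k (ι w₀))) - w₀‖)]
    simp only [hβ]
    linarith
  have hw₀ : Tendsto (fun n => ‖B n (ι (B n (ι w₀))) - w₀‖) atTop (𝓝 0) := by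
    have h1 := tendsto_iff_norm_sub_tendsto_zero.mp (hB.tendsto_id' w₀)
    refine squeeze_zero (fun n => norm_nonneg _) (fun n => ?_)
      (by simpa using h1.const_mul 4)
    have e : B n (ι (B n (ι w₀))) - w₀ = B n (ι (B n (ι w₀) - w₀)) + (B n (ι w₀) - w₀) := by
      simp only [map_sub]; abel
    rw [e]
    have a := norm_add_le (B n (ι (B n (ι w₀) - w₀))) (B n (ι w₀) - w₀)
    have b := hB.norm_le' n (B n (ι w₀) - w₀)
    linarith
  have hβ0 : ∀ T, Tendsto (β T) atTop (𝓝 0) := by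
    intro T
    have := ((hw₀.pow 2).const_mul 2).add (tendsto_integral_resolvent_error hB hu hf T)
    simpa using this
  have hUC : ∀ T, UniformCauchySeqOn D atTop (Icc 0 T) := by
    intro T
    rw [Metric.uniformCauchySeqOn_iff]
    intro δ hδ
    have : ∀ᶠ n in atTop, β T n < δ ^ 2 / 2 := (hβ0 T).eventually_lt_const (by positivity)
    obtain ⟨N, hN⟩ := eventually_atTop.mp this
    refine ⟨N, fun m hm n hn t ht => ?_⟩
    rw [dist_eq_norm]
    have h1 := hkey T m n t ht
    have h2 := hN m hm
    have h3 := hN n hn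
    exact lt_of_pow_lt_pow_left₀ 2 hδ.le (by linarith)
  have hlim : ∀ t, ∃ p : V, 0 ≤ t → Tendsto (fun n => D n t) atTop (𝓝 p) := by
    intro t
    by_cases ht : 0 ≤ t
    · obtain ⟨p, hp⟩ := cauchySeq_tendsto_of_complete
        ((hUC t).cauchySeq (right_mem_Icc.mpr ht))
      exact ⟨p, fun _ => hp⟩
    · exact ⟨0, fun h => absurd h ht⟩
  choose p hp using hlim
  refine ⟨p, ?_, ?_⟩
  · intro t ht
    have h1 : ContinuousOn p (Icc 0 (t + 1)) := by
      refine TendstoUniformlyOn.continuousOn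
        ((hUC (t + 1)).tendstoUniformlyOn_of_tendsto fun s hs => hp s hs.1) ?_
      refine Frequently.of_forall fun n => Continuous.continuousOn ?_
      fun_prop
    refine (h1 t ⟨ht, by linarith⟩).mono_of_mem_nhdsWithin ?_
    have : Ici (0 : ℝ) ∩ Iio (t + 1) ⊆ Icc 0 (t + 1) := fun s hs => ⟨hs.1, hs.2.le⟩
    exact mem_of_superset (inter_mem_nhdsWithin _ (Iio_mem_nhds (by linarith))) this
  · intro t ht
    have h1 : Tendsto (fun n => ι (D n t)) atTop (𝓝 (ι (p t))) :=
      (ι.continuous.tendsto _).comp (hp t ht)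
    refine tendsto_nhds_unique h1 ?_
    rw [tendsto_iff_norm_sub_tendsto_zero]
    have h2 := tendsto_iff_norm_sub_tendsto_zero.mp (hB.tendsto_id (u t))
    refine squeeze_zero (fun n => norm_nonneg _) (fun n => ?_)
      (by simpa using h2.const_mul 2)
    have e : ι (D n t) - u t = ι (B n (ι (B n (u t)) - u t)) + (ι (B n (u t)) - u t) := by
      simp only [hD, map_sub]; abel
    rw [e]
    have a := norm_add_le (ι (B n (ι (B n (u t)) - u t))) (ι (B n (u t)) - u t)
    have b := hB.norm_le n (ι (B n (u t)) - u t)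
    linarith

/-- Freezing a curve at its initial value for negative times makes it continuous on all of ℝ without
touching the times that matter. -/
lemma continuous_comp_max_zero {X : Type*} [TopologicalSpace X] {p : ℝ → X}
    (hp : ContinuousOn p (Ici 0)) : Continuous fun t => p (max t 0) :=
  hp.comp_continuous (by fun_prop) fun t => le_max_right t 0

/-- Solutions which are continuous with values in `V` satisfy the usual weak formulation. -/
lemma IsVeryWeakSolution.weak_form {ι : V →L[ℝ] H} (hinj : Function.Injective ι)
    {u₀ : H} {u f : ℝ → H} (h : IsVeryWeakSolution ι u₀ u f) (hf : Continuous f) {p : ℝ → V}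
    (hp : ContinuousOn p (Ici 0)) (hpu : ∀ t, 0 ≤ t → ι (p t) = u t) {φ : ℝ → V}
    (hφ : ContDiff ℝ 1 φ) {T : ℝ} (hT : 0 ≤ T) :
    inner ℝ (u T) (ι (φ T)) - ∫ t in (0)..T, inner ℝ (u t) (ι (deriv φ t))
      = inner ℝ u₀ (ι (φ 0))
        - (∫ t in (0)..T, (inner ℝ (p t) (φ t) - inner ℝ (ι (p t)) (ι (φ t))))
        + ∫ t in (0)..T, inner ℝ (f t) (ι (φ t)) := by
  set A := ContinuousLinearMap.adjoint ι
  set P : ℝ → V := fun t => p (max t 0) with hPdef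
  have hP : Continuous P := continuous_comp_max_zero hp
  have hPp : ∀ t, 0 ≤ t → P t = p t := fun t ht => by simp [hPdef, ht]
  set Γ : ℝ → V := fun t => A (f t) - P t + A (ι (P t)) with hΓdef
  have hΓ : Continuous Γ := by fun_prop
  -- The equation in the dual of `V`, transported to `V` by the Riesz map: f enters as A f, and L p
  -- as p - A (ι p). Elements A z are admissible tests, with L (A z) = z - ι (A z), and they
  -- separate points of `V` because `ι` is injective.
  have hG : ∀ t, 0 ≤ t → A (u t) = A u₀ + ∫ s in (0)..t, Γ s := by
    intro t ht
    apply hinj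
    refine ext_inner_right ℝ fun z => ?_
    have hw : ∀ q, inner ℝ (A z) q - inner ℝ (ι (A z)) (ι q) = inner ℝ (z - ι (A z)) (ι q) := by
      intro q
      rw [inner_sub_left, ContinuousLinearMap.adjoint_inner_left]
    have h1 := h _ _ hw t ht
    have e1 : ∀ x, inner ℝ (ι x) z = inner ℝ (A z) x := fun x => by
      rw [ContinuousLinearMap.adjoint_inner_left, real_inner_comm]
    have e2 : ∀ x y, inner ℝ (A x) y = inner ℝ x (ι y) := fun x y =>
      ContinuousLinearMap.adjoint_inner_left _ _ _
    have e3 : ∀ x, inner ℝ (A z) (A x) = inner ℝ x (ι (A z)) := fun x => by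
      rw [real_inner_comm, e2]
    rw [e1, e1, inner_add_right, ← innerSL_apply_apply ℝ (A z) (intervalIntegral _ _ _ _),
      ← ContinuousLinearMap.intervalIntegral_comp_comm _ (hΓ.intervalIntegrable _ _),
      real_inner_comm, e2, h1, real_inner_comm (A u₀), e2]
    congr 1
    refine intervalIntegral.integral_congr fun s hs => ?_
    rw [uIcc_of_le ht] at hs
    simp only [innerSL_apply_apply, hΓdef, inner_add_right, inner_sub_right]
    rw [e3, e3, e2 z, hPp s hs.1, hpu s hs.1, real_inner_comm (u s) z]
    ring
  have hd := hasDerivAt_const_add_integral (A u₀) hΓ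
  have hφd : ∀ t, HasDerivAt φ (deriv φ t) t := fun t =>
    (hφ.differentiable one_ne_zero).differentiableAt.hasDerivAt
  have hφ' : Continuous (deriv φ) := hφ.continuous_deriv le_rfl
  have hφc : Continuous φ := hφ.continuous
  have hcont : Continuous (fun t => A u₀ + ∫ s in (0)..t, Γ s) :=
    continuous_iff_continuousAt.mpr fun t => (hd t).continuousAt
  have hftc := intervalIntegral.integral_eq_sub_of_hasDerivAt (a := 0) (b := T)
    (fun s _ => (hd s).inner ℝ (hφd s)) (Continuous.intervalIntegrable (by fun_prop) _ _)
  rw [intervalIntegral.integral_add (Continuous.intervalIntegrable (by fun_prop) _ _)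
    (Continuous.intervalIntegrable (by fun_prop) _ _), intervalIntegral.integral_same, add_zero,
    ← hG T hT, ContinuousLinearMap.adjoint_inner_left, ContinuousLinearMap.adjoint_inner_left]
    at hftc
  have i1 : ∫ t in (0)..T, inner ℝ (u t) (ι (deriv φ t))
      = ∫ t in (0)..T, inner ℝ (A u₀ + ∫ s in (0)..t, Γ s) (deriv φ t) := by
    refine intervalIntegral.integral_congr fun s hs => ?_
    rw [uIcc_of_le hT] at hs
    rw [← hG s hs.1, ContinuousLinearMap.adjoint_inner_left]
  have i2 : (∫ t in (0)..T, (inner ℝ (p t) (φ t) - inner ℝ (ι (p t)) (ι (φ t))))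
      = ∫ t in (0)..T, (inner ℝ (P t) (φ t) - inner ℝ (ι (P t)) (ι (φ t))) := by
    refine intervalIntegral.integral_congr fun s hs => ?_
    rw [uIcc_of_le hT] at hs
    rw [hPp s hs.1]
  have i3 : ∫ t in (0)..T, inner ℝ (Γ t) (φ t)
      = (∫ t in (0)..T, inner ℝ (f t) (ι (φ t)))
        - ∫ t in (0)..T, (inner ℝ (P t) (φ t) - inner ℝ (ι (P t)) (ι (φ t))) := by
    rw [← intervalIntegral.integral_sub (Continuous.intervalIntegrable (by fun_prop) _ _)
      (Continuous.intervalIntegrable (by fun_prop) _ _)]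
    refine intervalIntegral.integral_congr fun s hs => ?_
    simp only [hΓdef, inner_add_left, inner_sub_left]
    rw [ContinuousLinearMap.adjoint_inner_left, ContinuousLinearMap.adjoint_inner_left]
    ring
  rw [i1, i2]
  linarith

end AbstractEvolution

/-! ### Norm convergence of bounded operators -/

section OperatorNorm

variable {F F' : Type*} [NormedAddCommGroup F] [NormedSpace ℝ F] [NormedAddCommGroup F']
  [NormedSpace ℝ F']

lemma norm_clm_sub_self (A : F →L[ℝ] F') : ‖A - A‖ = 0 := by simp

lemma tendsto_norm_clm_sub {X : Type*} {l : Filter X} {A : X → F →L[ℝ] F'} {A₀ : F →L[ℝ] F'}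
    (hA : Tendsto A l (𝓝 A₀)) :
    Tendsto (fun m : X × X => ‖A m.1 - A m.2‖) (l ×ˢ l) (𝓝 0) := by
  have := (hA.comp (tendsto_fst (f := l) (g := l))).sub (hA.comp (tendsto_snd (f := l) (g := l)))
  rw [sub_self] at this
  simpa using this.norm

lemma eventually_norm_clm_le {X : Type*} {l : Filter X} {A : X → F →L[ℝ] F'} {A₀ : F →L[ℝ] F'}
    (hA : Tendsto A l (𝓝 A₀)) : ∀ᶠ m in l, ‖A m‖ ≤ ‖A₀‖ + 1 :=
  (hA.norm.eventually_lt_const (lt_add_one _)).mono fun _ h => h.le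

lemma tendsto_clm_apply {X : Type*} {l : Filter X} {A : X → F →L[ℝ] F'} {A₀ : F →L[ℝ] F'}
    (hA : Tendsto A l (𝓝 A₀)) {x : X → F} {x₀ : F} (hx : Tendsto x l (𝓝 x₀)) :
    Tendsto (fun m => A m (x m)) l (𝓝 (A₀ x₀)) :=
  (isBoundedBilinearMap_apply.continuous.tendsto (A₀, x₀)).comp (hA.prodMk_nhds hx)

end OperatorNorm

/-! ### Stability, uniqueness and limits for the coupled system -/

section CoupledSystem

variable {V H Y : Type*} [NormedAddCommGroup V] [InnerProductSpace ℝ V] [CompleteSpace V]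
  [NormedAddCommGroup H] [InnerProductSpace ℝ H] [CompleteSpace H]
  [NormedAddCommGroup Y] [InnerProductSpace ℝ Y] [CompleteSpace Y]

/-- Grönwall's inequality in integral form. -/
lemma le_mul_exp_of_le_add_mul_integral {e : ℝ → ℝ} (he : Continuous e) {a K T : ℝ} (hK : 0 ≤ K)
    (h : ∀ t ∈ Icc 0 T, e t ≤ a + K * ∫ s in (0)..t, e s) {t : ℝ} (ht : t ∈ Icc 0 T) :
    e t ≤ a * Real.exp (K * t) := by
  set F : ℝ → ℝ := fun t => a + ∫ s in (0)..t, K * e s with hF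
  have hd : ∀ t, HasDerivAt F (K * e t) t := hasDerivAt_const_add_integral a (by fun_prop)
  have hΨ : ∀ t, HasDerivAt (fun t => Real.exp (-K * t) * F t)
      (Real.exp (-K * t) * (-K * 1) * F t + Real.exp (-K * t) * (K * e t)) t := fun t =>
    (((hasDerivAt_id t).const_mul (-K)).exp).mul (hd t)
  have hFe : ∀ t ∈ Icc 0 T, e t ≤ F t := by
    intro t ht
    simp only [hF, intervalIntegral.integral_const_mul]
    exact h t ht
  have hanti : AntitoneOn (fun t => Real.exp (-K * t) * F t) (Icc 0 T) := by
    refine antitoneOn_of_deriv_nonpos (convex_Icc 0 T)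
      (fun t _ => (hΨ t).continuousAt.continuousWithinAt)
      (fun t _ => (hΨ t).differentiableAt.differentiableWithinAt) fun t ht => ?_
    rw [(hΨ t).deriv]
    have h1 := mul_nonneg (mul_nonneg (Real.exp_pos (-K * t)).le hK)
      (sub_nonneg.mpr (hFe t (interior_subset ht)))
    linarith
  have h1 := hanti (left_mem_Icc.mpr (ht.1.trans ht.2)) ht ht.1
  have h2 : F 0 = a := by simp [hF]
  simp only [mul_zero, Real.exp_zero, one_mul, h2] at h1
  have h3 : F t = Real.exp (K * t) * (Real.exp (-K * t) * F t) := by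
    rw [← mul_assoc, ← Real.exp_add]; simp
  calc e t ≤ F t := hFe t ht
    _ ≤ Real.exp (K * t) * a := by rw [h3]; gcongr
    _ = _ := mul_comm _ _

/-- Energy estimate for a pair `(u, v)` with `u' + L u = f`, `v' = g`. -/
lemma IsVeryWeakSolution.pair_estimate {ι : V →L[ℝ] H} (hι : ∀ p, ‖ι p‖ ≤ ‖p‖)
    (hinj : Function.Injective ι) (hd : DenseRange ι) {u₀ : H} {v₀ : Y} {u f : ℝ → H} {v g : ℝ → Y}
    (h : IsVeryWeakSolution ι u₀ u f) (hu : Continuous u) (hf : Continuous f)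
    (hv : Continuous v) (hg : Continuous g)
    (hvg : ∀ t, 0 ≤ t → v t = v₀ + ∫ s in (0)..t, g s) {C δ T : ℝ} (hC : 0 ≤ C)
    (hfg : ∀ t ∈ Icc 0 T, ‖(f t, g t)‖ ≤ C * ‖(u t, v t)‖ + δ) {t : ℝ} (ht : t ∈ Icc 0 T) :
    ‖(u t, v t)‖ ^ 2
      ≤ (‖u₀‖ ^ 2 + ‖v₀‖ ^ 2 + 4 * δ ^ 2 * T) * Real.exp ((4 * C + 1) * T) := by
  set e : ℝ → ℝ := fun t => ‖u t‖ ^ 2 + ‖v t‖ ^ 2 with he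
  have hec : Continuous e := by fun_prop
  -- The product carries the maximum norm, whereas the energy is the sum of the squares.
  have hNe : ∀ t, ‖(u t, v t)‖ ^ 2 ≤ e t := by
    intro t
    rw [Prod.norm_def]
    rcases max_cases ‖u t‖ ‖v t‖ with h | h <;> simp only [h.1, he] <;>
      nlinarith [sq_nonneg ‖u t‖, sq_nonneg ‖v t‖]
  have hmain : ∀ t ∈ Icc 0 T, e t ≤ (‖u₀‖ ^ 2 + ‖v₀‖ ^ 2 + 4 * δ ^ 2 * T)
      + (4 * C + 1) * ∫ s in (0)..t, e s := by
    intro t ht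
    have h1 := h.energy hι hinj hd hu hf ht.1
    have h2 : ‖v t‖ ^ 2 = ‖v₀‖ ^ 2 + ∫ s in (0)..t, 2 * inner ℝ (v s) (g s) := by
      rw [hvg t ht.1, norm_sq_const_add_integral v₀ hg]
      congr 1
      refine intervalIntegral.integral_congr fun s hs => ?_
      rw [uIcc_of_le ht.1] at hs
      rw [← hvg s hs.1]
    have h3 : (∫ s in (0)..t, 2 * inner ℝ (u s) (f s)) + (∫ s in (0)..t, 2 * inner ℝ (v s) (g s))
        ≤ ∫ s in (0)..t, ((4 * C + 1) * e s + 4 * δ ^ 2) := by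
      rw [← intervalIntegral.integral_add (Continuous.intervalIntegrable (by fun_prop) _ _)
        (Continuous.intervalIntegrable (by fun_prop) _ _)]
      refine intervalIntegral.integral_mono_on ht.1
        (Continuous.intervalIntegrable (by fun_prop) _ _)
        (Continuous.intervalIntegrable (by fun_prop) _ _) fun s hs => ?_
      have hs' := hfg s ⟨hs.1, hs.2.trans ht.2⟩
      have a1 := norm_fst_le (f s, g s)
      have a2 := norm_snd_le (f s, g s)
      have a3 := norm_fst_le (u s, v s)
      have a4 := norm_snd_le (u s, v s)
      simp only at a1 a2 a3 a4
      have b1 := real_inner_le_norm (u s) (f s)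
      have b2 := real_inner_le_norm (v s) (g s)
      have b3 := hNe s
      set N := ‖(u s, v s)‖
      have hN : 0 ≤ N := norm_nonneg _
      have c1 : ‖u s‖ * ‖f s‖ ≤ N * (C * N + δ) :=
        mul_le_mul a3 (a1.trans hs') (norm_nonneg _) hN
      have c2 : ‖v s‖ * ‖g s‖ ≤ N * (C * N + δ) :=
        mul_le_mul a4 (a2.trans hs') (norm_nonneg _) hN
      have c3 : (4 * C + 1) * N ^ 2 ≤ (4 * C + 1) * e s := by gcongr
      -- The two products together contribute at most 4N(CN + δ), and 4Nδ ≤ N² + 4δ²; this is the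
      -- origin of the constants 4C + 1 and 4δ².
      nlinarith [sq_nonneg (N - 2 * δ)]
    rw [intervalIntegral.integral_add (Continuous.intervalIntegrable (by fun_prop) _ _)
      (Continuous.intervalIntegrable (by fun_prop) _ _),
      intervalIntegral.integral_const_mul (4 * C + 1) e,
      intervalIntegral.integral_const, smul_eq_mul, sub_zero] at h3
    have h4 : t * (4 * δ ^ 2) ≤ 4 * δ ^ 2 * T := by
      rw [mul_comm]; gcongr; exact ht.2
    simp only [he] at h3 ⊢
    linarith
  have hT : 0 ≤ T := ht.1.trans ht.2
  calc ‖(u t, v t)‖ ^ 2 ≤ e t := hNe t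
    _ ≤ (‖u₀‖ ^ 2 + ‖v₀‖ ^ 2 + 4 * δ ^ 2 * T) * Real.exp ((4 * C + 1) * t) :=
      le_mul_exp_of_le_add_mul_integral hec (by positivity) hmain ht
    _ ≤ _ := by gcongr; exact ht.2

/-- Solutions of the system `u' + L u = f`, `v' = g`, `(f, g) = A (u, v)`. -/
structure IsCoupledSolution (ι : V →L[ℝ] H) (A : H × Y →L[ℝ] H × Y) (u₀ : H) (v₀ : Y)
    (u : ℝ → H) (v : ℝ → Y) : Prop where
  continuous_u : Continuous u
  continuous_v : Continuous v
  eq_u : IsVeryWeakSolution ι u₀ u fun t => (A (u t, v t)).1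
  eq_v : ∀ t, 0 ≤ t → v t = v₀ + ∫ s in (0)..t, (A (u s, v s)).2

variable {ι : V →L[ℝ] H} {A A' : H × Y →L[ℝ] H × Y} {u₀ : H} {v₀ : Y} {u u' : ℝ → H}
  {v v' : ℝ → Y}

lemma IsCoupledSolution.norm_sq_le (hι : ∀ p, ‖ι p‖ ≤ ‖p‖) (hinj : Function.Injective ι)
    (hd : DenseRange ι) (h : IsCoupledSolution ι A u₀ v₀ u v) {C : ℝ} (hC : ‖A‖ ≤ C) {T t : ℝ}
    (ht : t ∈ Icc 0 T) :
    ‖(u t, v t)‖ ^ 2 ≤ (‖u₀‖ ^ 2 + ‖v₀‖ ^ 2) * Real.exp ((4 * C + 1) * T) := by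
  have hu := h.continuous_u
  have hv := h.continuous_v
  have := h.eq_u.pair_estimate hι hinj hd hu (by fun_prop) hv (by fun_prop) h.eq_v
    ((norm_nonneg A).trans hC) (δ := 0) (T := T) (fun s _ => ?_) ht
  · simpa using this
  · rw [add_zero]
    exact (A.le_opNorm _).trans (by gcongr)

/-- The difference of the solutions has zero initial data and right side A (x - x') + (A - A') x'.
The last term is a perturbation of size at most ‖A - A'‖ M, and only x' needs an a priori bound. -/
lemma IsCoupledSolution.dist_sq_le (hι : ∀ p, ‖ι p‖ ≤ ‖p‖) (hinj : Function.Injective ι)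
    (hd : DenseRange ι) (h : IsCoupledSolution ι A u₀ v₀ u v)
    (h' : IsCoupledSolution ι A' u₀ v₀ u' v') {C : ℝ} (hC : ‖A‖ ≤ C) {M T t : ℝ}
    (hM : ∀ t ∈ Icc 0 T, ‖(u' t, v' t)‖ ≤ M) (ht : t ∈ Icc 0 T) :
    dist (u t, v t) (u' t, v' t) ^ 2
      ≤ 4 * (‖A - A'‖ * M) ^ 2 * T * Real.exp ((4 * C + 1) * T) := by
  have hu := h.continuous_u
  have hv := h.continuous_v
  have hu' := h'.continuous_u
  have hv' := h'.continuous_v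
  have h1 := h.eq_u.sub h'.eq_u hu (by fun_prop) hu' (by fun_prop)
  have := h1.pair_estimate hι hinj hd (v₀ := (0 : Y)) (v := fun t => v t - v' t)
    (g := fun t => (A (u t, v t)).2 - (A' (u' t, v' t)).2) (by fun_prop) (by fun_prop)
    (by fun_prop) (by fun_prop) ?_
    ((norm_nonneg A).trans hC) (δ := ‖A - A'‖ * M) (T := T) (fun s hs => ?_) ht
  · rw [dist_eq_norm]
    simpa using this
  · intro s hs
    rw [h.eq_v s hs, h'.eq_v s hs, intervalIntegral.integral_sub]
    · abel
    · exact Continuous.intervalIntegrable (by fun_prop) _ _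
    · exact Continuous.intervalIntegrable (by fun_prop) _ _
  · have e : ((A (u s, v s)).1 - (A' (u' s, v' s)).1, (A (u s, v s)).2 - (A' (u' s, v' s)).2)
        = A (u s - u' s, v s - v' s) + (A - A') (u' s, v' s) := by
      have : (u s - u' s, v s - v' s) = (u s, v s) - (u' s, v' s) := rfl
      rw [this, map_sub, sub_apply, sub_add_sub_cancel]
      rfl
    rw [e]
    refine (norm_add_le _ _).trans (add_le_add ?_ ?_)
    · exact (A.le_opNorm _).trans (by gcongr)
    · exact ((A - A').le_opNorm _).trans (by gcongr; exact hM s hs)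

lemma IsCoupledSolution.unique (hι : ∀ p, ‖ι p‖ ≤ ‖p‖) (hinj : Function.Injective ι)
    (hd : DenseRange ι) (h : IsCoupledSolution ι A u₀ v₀ u v)
    (h' : IsCoupledSolution ι A u₀ v₀ u' v') {t : ℝ} (ht : 0 ≤ t) :
    u t = u' t ∧ v t = v' t := by
  have hb : ∀ s ∈ Icc 0 t, ‖(u' s, v' s)‖
      ≤ √((‖u₀‖ ^ 2 + ‖v₀‖ ^ 2) * Real.exp ((4 * ‖A‖ + 1) * t)) := fun s hs =>
    Real.le_sqrt_of_sq_le (h'.norm_sq_le hι hinj hd le_rfl hs)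
  have := h.dist_sq_le hι hinj hd h' le_rfl hb (right_mem_Icc.mpr ht)
  rw [norm_clm_sub_self] at this
  have h0 : dist (u t, v t) (u' t, v' t) ^ 2 = 0 := le_antisymm (by simpa using this) (sq_nonneg _)
  exact Prod.ext_iff.mp (dist_eq_zero.mp (pow_eq_zero_iff two_ne_zero |>.mp h0))

/-- Solutions converge, uniformly on bounded time intervals, if the coupling operators converge. -/
lemma exists_limit_coupledSolution (hι : ∀ p, ‖ι p‖ ≤ ‖p‖) (hinj : Function.Injective ι)
    (hd : DenseRange ι) {A : ℝ → H × Y →L[ℝ] H × Y} {A₀ : H × Y →L[ℝ] H × Y}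
    (hA : Tendsto A (𝓝[>] 0) (𝓝 A₀)) {u : ℝ → ℝ → H} {v : ℝ → ℝ → Y}
    (h : ∀ ε ∈ Ioc (0 : ℝ) 1, IsCoupledSolution ι (A ε) u₀ v₀ (u ε) (v ε)) :
    ∃ (U : ℝ → H) (W : ℝ → Y), IsCoupledSolution ι A₀ u₀ v₀ U W ∧
      ∀ T, TendstoUniformlyOn (fun ε t => (u ε t, v ε t)) (fun t => (U t, W t)) (𝓝[>] 0)
        (Icc 0 T) := by
  set x : ℝ → ℝ → H × Y := fun ε t => (u ε t, v ε t) with hx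
  -- The slack 1 makes C a bound for ‖A ε‖ for all small ε.
  set C := ‖A₀‖ + 1
  set M : ℝ → ℝ := fun T => √((‖u₀‖ ^ 2 + ‖v₀‖ ^ 2) * Real.exp ((4 * C + 1) * T))
  have hev : ∀ᶠ ε in 𝓝[>] (0 : ℝ), ε ∈ Ioc (0 : ℝ) 1 ∧ ‖A ε‖ ≤ C := by
    filter_upwards [Ioc_mem_nhdsGT one_pos, eventually_norm_clm_le hA] with ε h h1 using ⟨h, h1⟩
  have hM : ∀ ε, ε ∈ Ioc (0 : ℝ) 1 ∧ ‖A ε‖ ≤ C → ∀ T, ∀ t ∈ Icc 0 T, ‖x ε t‖ ≤ M T :=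
    fun ε hε T t ht => Real.le_sqrt_of_sq_le ((h ε hε.1).norm_sq_le hι hinj hd hε.2 ht)
  have hUC : ∀ T, UniformCauchySeqOn x (𝓝[>] 0) (Icc 0 T) := by
    intro T s hs
    obtain ⟨δ, hδ, hδs⟩ := Metric.mem_uniformity_dist.mp hs
    have h1 : Tendsto (fun m : ℝ × ℝ => 4 * (‖A m.1 - A m.2‖ * M T) ^ 2 * T
        * Real.exp ((4 * C + 1) * T)) (𝓝[>] 0 ×ˢ 𝓝[>] 0) (𝓝 0) := by
      have a1 := tendsto_norm_clm_sub hA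
      have a2 := ((((a1).mul_const (M T)).pow 2).const_mul 4).mul_const T
      have a3 := a2.mul_const (Real.exp ((4 * C + 1) * T))
      simpa using a3
    filter_upwards [h1.eventually_lt_const (show 0 < δ ^ 2 by positivity),
      hev.prod_mk hev] with m hm hm2 t ht
    refine hδs ?_
    have := (h m.1 hm2.1.1).dist_sq_le hι hinj hd (h m.2 hm2.2.1) hm2.1.2 (hM m.2 hm2.2 T) ht
    exact lt_of_pow_lt_pow_left₀ 2 hδ.le (this.trans_lt hm)
  have hlim : ∀ t, ∃ p : H × Y, 0 ≤ t → Tendsto (fun ε => x ε t) (𝓝[>] 0) (𝓝 p) := by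
    intro t
    by_cases ht : 0 ≤ t
    · obtain ⟨p, hp⟩ := cauchy_map_iff_exists_tendsto.mp
        ((hUC t).cauchy_map (right_mem_Icc.mpr ht))
      exact ⟨p, fun _ => hp⟩
    · exact ⟨0, fun h => absurd h ht⟩
  choose p hp using hlim
  have hunif : ∀ T, TendstoUniformlyOn x p (𝓝[>] 0) (Icc 0 T) := fun T =>
    (hUC T).tendstoUniformlyOn_of_tendsto fun s hs => hp s hs.1
  have hpc : ContinuousOn p (Ici 0) := by
    intro t ht
    have h1 : ContinuousOn p (Icc 0 (t + 1)) := by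
      refine (hunif (t + 1)).continuousOn (Eventually.frequently ?_)
      filter_upwards [hev] with ε hε
      exact ((h ε hε.1).continuous_u.prodMk (h ε hε.1).continuous_v).continuousOn
    refine (h1 t ⟨ht, by linarith⟩).mono_of_mem_nhdsWithin ?_
    have : Ici (0 : ℝ) ∩ Iio (t + 1) ⊆ Icc 0 (t + 1) := fun s hs => ⟨hs.1, hs.2.le⟩
    exact mem_of_superset (inter_mem_nhdsWithin _ (Iio_mem_nhds (by linarith))) this
  set P : ℝ → H × Y := fun t => p (max t 0) with hP
  have hPc : Continuous P := continuous_comp_max_zero hpc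
  have hPp : ∀ t, 0 ≤ t → P t = p t := fun t ht => by simp [hP, ht]
  have hPt : ∀ t, 0 ≤ t → Tendsto (fun ε => x ε t) (𝓝[>] 0) (𝓝 (P t)) := fun t ht => by
    rw [hPp t ht]; exact hp t ht
  have hAx : ∀ t, 0 ≤ t → Tendsto (fun ε => A ε (x ε t)) (𝓝[>] 0) (𝓝 (A₀ (P t))) :=
    fun t ht => tendsto_clm_apply hA (hPt t ht)
  have hAb : ∀ ε, ε ∈ Ioc (0 : ℝ) 1 ∧ ‖A ε‖ ≤ C → ∀ T, ∀ t ∈ Icc 0 T,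
      ‖A ε (x ε t)‖ ≤ C * M T := fun ε hε T t ht =>
    ((A ε).le_opNorm _).trans
      (mul_le_mul hε.2 (hM ε hε T t ht) (norm_nonneg _) (by positivity))
  refine ⟨fun t => (P t).1, fun t => (P t).2, ⟨by fun_prop, by fun_prop, ?_, ?_⟩, ?_⟩
  · intro w z hwz t ht
    -- In the very weak formulation no derivative falls on the solution, so pointwise convergence in
    -- time and a uniform bound suffice to pass to the limit.
    have h1 : ∀ᶠ ε in 𝓝[>] (0 : ℝ), inner ℝ u₀ (ι w) + ∫ s in (0)..t,
        (inner ℝ (A ε (x ε s)).1 (ι w) - inner ℝ (u ε s) z) = inner ℝ (u ε t) (ι w) := by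
      filter_upwards [hev] with ε hε
      exact ((h ε hε.1).eq_u w z hwz t ht).symm
    refine (tendsto_nhds_unique_of_eventuallyEq (Tendsto.const_add _ ?_)
      (((continuous_fst.tendsto _).comp (hPt t ht)).inner tendsto_const_nhds) h1).symm
    refine intervalIntegral.tendsto_integral_filter_of_dominated_convergence
      (fun s => C * M t * ‖ι w‖ + M t * ‖z‖) ?_ ?_ ?_ ?_
    · filter_upwards [hev] with ε hε
      have hu := (h ε hε.1).continuous_u
      have hv := (h ε hε.1).continuous_v
      exact Continuous.aestronglyMeasurable (by fun_prop)
    · filter_upwards [hev] with ε hε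
      refine Eventually.of_forall fun s hs => ?_
      rw [uIoc_of_le ht] at hs
      have hs' : s ∈ Icc 0 t := ⟨hs.1.le, hs.2⟩
      refine (norm_sub_le _ _).trans (add_le_add ?_ ?_)
      · refine (norm_inner_le_norm _ _).trans ?_
        gcongr
        exact (norm_fst_le _).trans (hAb ε hε t s hs')
      · refine (norm_inner_le_norm _ _).trans ?_
        gcongr
        exact (norm_fst_le (x ε s)).trans (hM ε hε t s hs')
    · exact Continuous.intervalIntegrable (by fun_prop) _ _
    · refine Eventually.of_forall fun s hs => ?_
      rw [uIoc_of_le ht] at hs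
      exact (((continuous_fst.tendsto _).comp (hAx s hs.1.le)).inner tendsto_const_nhds).sub
        (((continuous_fst.tendsto _).comp (hPt s hs.1.le)).inner tendsto_const_nhds)
  · intro t ht
    have h1 : ∀ᶠ ε in 𝓝[>] (0 : ℝ), v₀ + ∫ s in (0)..t, (A ε (x ε s)).2 = v ε t := by
      filter_upwards [hev] with ε hε
      exact ((h ε hε.1).eq_v t ht).symm
    refine (tendsto_nhds_unique_of_eventuallyEq (Tendsto.const_add _ ?_)
      ((continuous_snd.tendsto _).comp (hPt t ht)) h1).symm
    refine intervalIntegral.tendsto_integral_filter_of_dominated_convergence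
      (fun s => C * M t) ?_ ?_ ?_ ?_
    · filter_upwards [hev] with ε hε
      have hu := (h ε hε.1).continuous_u
      have hv := (h ε hε.1).continuous_v
      exact Continuous.aestronglyMeasurable (by fun_prop)
    · filter_upwards [hev] with ε hε
      refine Eventually.of_forall fun s hs => ?_
      rw [uIoc_of_le ht] at hs
      exact (norm_snd_le _).trans (hAb ε hε t s ⟨hs.1.le, hs.2⟩)
    · exact Continuous.intervalIntegrable (by fun_prop) _ _
    · refine Eventually.of_forall fun s hs => ?_
      rw [uIoc_of_le ht] at hs
      exact (continuous_snd.tendsto _).comp (hAx s hs.1.le)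
  · intro T
    exact (hunif T).congr_right fun t ht => (hPp t ht.1).symm

end CoupledSystem

/-! ### The embedding of H¹(Ω) into L²(Ω): completeness, injectivity, density -/

section Sobolev

variable {N₁ N₂ : ℕ} {Ω : Set (E N₁ × E N₂)}

lemma integral_inner_eq_inner_toLp {X F : Type*} [MeasurableSpace X] {μ : Measure X}
    [NormedAddCommGroup F] [InnerProductSpace ℝ F] {ψ : X → F} (hψ : MemLp ψ 2 μ)
    (f : Lp F 2 μ) : ∫ x, inner ℝ (f x) (ψ x) ∂μ = inner ℝ f hψ.toLp := by
  rw [L2.inner_def]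
  refine integral_congr_ae ?_
  filter_upwards [hψ.coeFn_toLp] with x hx
  rw [hx]

lemma integral_mul_eq_inner_toLp {X : Type*} [MeasurableSpace X] {μ : Measure X}
    {ψ : X → ℝ} (hψ : MemLp ψ 2 μ) (f : Lp ℝ 2 μ) :
    ∫ x, f x * ψ x ∂μ = inner ℝ f hψ.toLp := by
  rw [← integral_inner_eq_inner_toLp]
  refine integral_congr_ae (Eventually.of_forall fun x => ?_)
  simp [mul_comm]

/-- For fixed test function and direction, both sides of the weak gradient identity are inner
products with fixed L² elements, hence continuous. -/
lemma isClosed_H1 : IsClosed (H1 Ω : Set (WithLp 2 (L2 Ω × L2Field Ω))) := by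
  have hset : (H1 Ω : Set (WithLp 2 (L2 Ω × L2Field Ω)))
      = ⋂ (φ : E N₁ × E N₂ → ℝ) (_ : ContDiff ℝ (⊤ : ℕ∞) φ) (_ : HasCompactSupport φ)
        (_ : tsupport φ ⊆ Ω) (e : E N₁ × E N₂),
        {p | ∫ x in Ω, p.fst x * fderiv ℝ φ x e
          = - ∫ x in Ω, inner ℝ (p.snd x) (WithLp.toLp 2 e) * φ x} := by
    ext p
    simp only [mem_iInter]
    rfl
  rw [hset]
  refine isClosed_iInter fun φ => isClosed_iInter fun hφ => isClosed_iInter fun hc =>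
    isClosed_iInter fun _ => isClosed_iInter fun e => isClosed_eq ?_ ?_
  · have hd : Continuous fun x => fderiv ℝ φ x e :=
      (hφ.continuous_fderiv (by simp)).clm_apply continuous_const
    have hm : MemLp (fun x => fderiv ℝ φ x e) 2 (volume.restrict Ω) :=
      hd.memLp_of_hasCompactSupport (hc.fderiv_apply ℝ e)
    simp_rw [integral_mul_eq_inner_toLp hm]
    exact (WithLp.fstL 2 ℝ (L2 Ω) (L2Field Ω)).continuous.inner continuous_const
  · have hm : MemLp (fun x => φ x • (WithLp.toLp 2 e : WithLp 2 (E N₁ × E N₂))) 2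
        (volume.restrict Ω) :=
      (hφ.continuous.smul continuous_const).memLp_of_hasCompactSupport hc.smul_right
    have e1 : ∀ g : L2Field Ω, ∫ x in Ω, inner ℝ (g x) (WithLp.toLp 2 e) * φ x
        = inner ℝ g hm.toLp := by
      intro g
      rw [← integral_inner_eq_inner_toLp]
      refine integral_congr_ae (Eventually.of_forall fun x => ?_)
      simp only [real_inner_smul_right, mul_comm]
    simp_rw [e1]
    exact ((WithLp.sndL 2 ℝ (L2 Ω) (L2Field Ω)).continuous.inner continuous_const).neg

instance : CompleteSpace (H1 Ω) := isClosed_H1.completeSpace_coe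

/-- The embedding of `H¹(Ω)` into `L²(Ω)`. -/
def embed (Ω : Set (E N₁ × E N₂)) : H1 Ω →L[ℝ] L2 Ω :=
  (WithLp.fstL 2 ℝ (L2 Ω) (L2Field Ω)).comp (H1 Ω).subtypeL

lemma embed_apply (p : H1 Ω) : embed Ω p = fnOf p := rfl

lemma inner_gradOf (p q : H1 Ω) :
    inner ℝ (gradOf p) (gradOf q) = inner ℝ p q - inner ℝ (fnOf p) (fnOf q) := by
  have : inner ℝ p q = inner ℝ (fnOf p) (fnOf q) + inner ℝ (gradOf p) (gradOf q) := rfl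
  rw [this]; ring

lemma norm_embed_le (p : H1 Ω) : ‖embed Ω p‖ ≤ ‖p‖ := by
  refine le_of_sq_le_sq ?_ (norm_nonneg _)
  have h := inner_gradOf p p
  rw [real_inner_self_eq_norm_sq, real_inner_self_eq_norm_sq, real_inner_self_eq_norm_sq] at h
  rw [embed_apply]
  nlinarith [sq_nonneg ‖gradOf p‖]

lemma ae_eq_zero_of_integral_mul_test (hΩo : IsOpen Ω) (hΩb : Bornology.IsBounded Ω)
    {f : E N₁ × E N₂ → ℝ} (hf : MemLp f 2 (volume.restrict Ω))
    (h : ∀ φ : E N₁ × E N₂ → ℝ, ContDiff ℝ (⊤ : ℕ∞) φ → HasCompactSupport φ → tsupport φ ⊆ Ω →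
      ∫ x in Ω, f x * φ x = 0) :
    f =ᵐ[volume.restrict Ω] 0 := by
  have : IsFiniteMeasure (volume.restrict Ω) :=
    isFiniteMeasure_restrict.mpr hΩb.measure_lt_top.ne
  have hi : IntegrableOn f Ω volume := hf.integrable (by norm_num)
  have := hΩo.ae_eq_zero_of_integral_contDiff_smul_eq_zero hi.locallyIntegrableOn
    fun φ hφ hc hs => by
      rw [← h φ hφ hc hs, setIntegral_eq_integral_of_forall_compl_eq_zero]
      · simp only [smul_eq_mul, mul_comm]
      · intro x hx
        rw [image_eq_zero_of_notMem_tsupport fun hx' => hx (hs hx'), mul_zero]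
  exact (ae_restrict_iff' hΩo.measurableSet).mpr this

/-- A weak gradient is determined by its function: if the function vanishes, every component of the
gradient in an orthonormal basis integrates to zero against all test functions. -/
lemma embed_injective (hΩo : IsOpen Ω) (hΩb : Bornology.IsBounded Ω) :
    Function.Injective (embed Ω) := by
  rw [injective_iff_map_eq_zero]
  intro p hp
  have hf : fnOf p = 0 := hp
  have hg : gradOf p = 0 := by
    rw [Lp.eq_zero_iff_ae_eq_zero]
    let b := stdOrthonormalBasis ℝ (WithLp 2 (E N₁ × E N₂))
    have h1 : ∀ i, (fun x => inner ℝ (gradOf p x) (b i)) =ᵐ[volume.restrict Ω] 0 := by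
      intro i
      refine ae_eq_zero_of_integral_mul_test hΩo hΩb ((Lp.memLp (gradOf p)).inner_const (b i)) ?_
      intro φ hφ hc hs
      have h := p.2 φ hφ hc hs (WithLp.ofLp (b i))
      have h2 : ∫ x in Ω, (fnOf p) x * fderiv ℝ φ x (WithLp.ofLp (b i)) = 0 := by
        refine integral_eq_zero_of_ae ?_
        rw [hf]
        filter_upwards [Lp.coeFn_zero ℝ 2 (volume.restrict Ω)] with x hx
        rw [hx]; exact zero_mul _
      rw [show ∫ x in Ω, (p : WithLp 2 (L2 Ω × L2Field Ω)).fst x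
        * fderiv ℝ φ x (WithLp.ofLp (b i)) = 0 from h2, zero_eq_neg] at h
      exact h
    filter_upwards [ae_all_iff.mpr h1] with x hx
    refine InnerProductSpace.ext_inner_right_basis b.toBasis fun i => ?_
    simpa using hx i
  refine Subtype.ext (WithLp.ofLp_injective 2 (Prod.ext hf hg))

/-- The gradient of a differentiable function on `ℝ^{N₁} × ℝ^{N₂}`. -/
def classicalGradient (φ : E N₁ × E N₂ → ℝ) (x : E N₁ × E N₂) : WithLp 2 (E N₁ × E N₂) :=
  (InnerProductSpace.toDual ℝ (WithLp 2 (E N₁ × E N₂))).symm ((fderiv ℝ φ x).comp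
    (WithLp.prodContinuousLinearEquiv 2 ℝ (E N₁) (E N₂)).toContinuousLinearMap)

lemma inner_classicalGradient (φ : E N₁ × E N₂ → ℝ) (x e : E N₁ × E N₂) :
    inner ℝ (classicalGradient φ x) (WithLp.toLp 2 e) = fderiv ℝ φ x e := by
  rw [classicalGradient, InnerProductSpace.toDual_symm_apply]
  rfl

lemma exists_H1_of_test {φ : E N₁ × E N₂ → ℝ} (hφ : ContDiff ℝ (⊤ : ℕ∞) φ)
    (hc : HasCompactSupport φ) (hs : tsupport φ ⊆ Ω) :
    ∃ p : H1 Ω, fnOf p =ᵐ[volume.restrict Ω] φ := by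
  have hfd : Continuous (fderiv ℝ φ) := hφ.continuous_fderiv (by simp)
  have h1 : MemLp φ 2 (volume.restrict Ω) := hφ.continuous.memLp_of_hasCompactSupport hc
  have hgc : Continuous (classicalGradient φ) :=
    (LinearIsometryEquiv.continuous _).comp (hfd.clm_comp continuous_const)
  have hgs : HasCompactSupport (classicalGradient φ) := by
    refine (hc.fderiv ℝ).mono' ?_
    refine (Function.support_subset_iff'.mpr fun x hx => ?_).trans (subset_tsupport _)
    rw [classicalGradient, Function.notMem_support.mp hx]
    simp
  have h2 : MemLp (classicalGradient φ) 2 (volume.restrict Ω) :=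
    hgc.memLp_of_hasCompactSupport hgs
  refine ⟨⟨WithLp.toLp 2 (h1.toLp, h2.toLp), ?_⟩, h1.coeFn_toLp⟩
  intro ψ hψ hψc hψs e
  have hψd : Continuous fun x => fderiv ℝ ψ x e :=
    (hψ.continuous_fderiv (by simp)).clm_apply continuous_const
  have hφd : Continuous fun x => fderiv ℝ φ x e := hfd.clm_apply continuous_const
  have e1 : ∫ x in Ω, (h1.toLp φ : L2 Ω) x * fderiv ℝ ψ x e = ∫ x, φ x * fderiv ℝ ψ x e := by
    rw [← setIntegral_eq_integral_of_forall_compl_eq_zero (s := Ω)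
      (f := fun x => φ x * fderiv ℝ ψ x e)]
    · refine integral_congr_ae ?_
      filter_upwards [h1.coeFn_toLp] with x hx
      rw [hx]
    · intro x hx
      rw [image_eq_zero_of_notMem_tsupport fun hx' => hx (hs hx'), zero_mul]
  have e2 : ∫ x in Ω, inner ℝ ((h2.toLp _ : L2Field Ω) x) (WithLp.toLp 2 e) * ψ x
      = ∫ x, fderiv ℝ φ x e * ψ x := by
    rw [← setIntegral_eq_integral_of_forall_compl_eq_zero (s := Ω)
      (f := fun x => fderiv ℝ φ x e * ψ x)]
    · refine integral_congr_ae ?_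
      filter_upwards [h2.coeFn_toLp] with x hx
      rw [hx, inner_classicalGradient]
    · intro x hx
      rw [image_eq_zero_of_notMem_tsupport fun hx' => hx (hψs hx'), mul_zero]
  change ∫ x in Ω, (h1.toLp φ : L2 Ω) x * fderiv ℝ ψ x e
    = -∫ x in Ω, inner ℝ ((h2.toLp _ : L2Field Ω) x) (WithLp.toLp 2 e) * ψ x
  rw [e1, e2]
  have : (volume : Measure (E N₁ × E N₂)).IsAddHaarMeasure := by
    rw [Measure.volume_eq_prod]; infer_instance
  refine integral_mul_fderiv_eq_neg_fderiv_mul_of_integrable ?_ ?_ ?_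
    (fun x _ => (hφ.differentiable (by simp)).differentiableAt)
    (fun x _ => (hψ.differentiable (by simp)).differentiableAt)
  · exact (hφd.mul hψ.continuous).integrable_of_hasCompactSupport hψc.mul_left
  · exact (hφ.continuous.mul hψd).integrable_of_hasCompactSupport hc.mul_right
  · exact (hφ.continuous.mul hψ.continuous).integrable_of_hasCompactSupport hc.mul_right

/-- A function orthogonal to the range is orthogonal to all test functions, since these lie in H¹(Ω)
with their classical gradients, and so it vanishes. -/
lemma denseRange_embed (hΩo : IsOpen Ω) (hΩb : Bornology.IsBounded Ω) :
    DenseRange (embed Ω) := by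
  have h1 : (LinearMap.range (embed Ω).toLinearMap).topologicalClosure = ⊤ := by
    rw [Submodule.topologicalClosure_eq_top_iff, Submodule.eq_bot_iff]
    intro f hf
    rw [Submodule.mem_orthogonal] at hf
    rw [Lp.eq_zero_iff_ae_eq_zero]
    refine ae_eq_zero_of_integral_mul_test hΩo hΩb (Lp.memLp f) fun φ hφ hc hs => ?_
    obtain ⟨p, hp⟩ := exists_H1_of_test hφ hc hs
    have h2 : inner ℝ (fnOf p) f = 0 := hf _ ⟨p, rfl⟩
    rw [← h2, L2.inner_def]
    refine integral_congr_ae ?_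
    filter_upwards [hp] with x hx
    simp [hx]
  have h2 := Submodule.dense_iff_topologicalClosure_eq_top.mpr h1
  rwa [LinearMap.coe_range] at h2

end Sobolev

/-! ### Integral operators of exchange type and their operator norm -/

section ExchangeOperators

variable {X Y : Type*} [MeasureSpace X] [MeasureSpace Y] {A : Set X} {B : Set Y}

lemma L2_norm_sq {α : Type*} [MeasurableSpace α] {μ : Measure α} (f : Lp ℝ 2 μ) :
    ‖f‖ ^ 2 = ∫ x, f x ^ 2 ∂μ := by
  rw [← real_inner_self_eq_norm_sq, L2.inner_def]
  refine integral_congr_ae (Eventually.of_forall fun x => ?_)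
  simp [sq]

lemma integral_abs_le_mul_norm {α : Type*} [MeasurableSpace α] {μ : Measure α} [IsFiniteMeasure μ]
    (f : Lp ℝ 2 μ) : ∫ x, |f x| ∂μ ≤ √(μ.real univ) * ‖f‖ := by
  have h := sq_integral_le μ (Lp.memLp f).abs
  refine le_of_sq_le_sq ?_ (by positivity)
  rw [mul_pow, Real.sq_sqrt measureReal_nonneg, L2_norm_sq]
  simpa using h

/-- A measurable kernel bounded by `M` on `A × B`. -/
structure IsBoundedKernel (A : Set X) (B : Set Y) (k : X → Y → ℝ) (M : ℝ) : Prop where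
  measurable : Measurable (Function.uncurry k)
  nonneg : 0 ≤ M
  abs_le : ∀ x ∈ A, ∀ y ∈ B, |k x y| ≤ M

/-- `L (u, v) x = ∫_B k(x,y) (c₁ v(y) - c₂ u(x)) dy`, for `u ∈ L²(A)` and `v ∈ L²(B)`. -/
def IsExchangeOp (k : X → Y → ℝ) (c₁ c₂ : ℝ) (L : L2 A × L2 B →L[ℝ] L2 A) : Prop :=
  ∀ u v, L (u, v) =ᵐ[volume.restrict A] fun x => ∫ y in B, k x y * (c₁ * v y - c₂ * u x)

variable [IsFiniteMeasure (volume.restrict A)] [IsFiniteMeasure (volume.restrict B)]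

lemma IsBoundedKernel.integrable_mul {k : X → Y → ℝ} {M : ℝ} (hk : IsBoundedKernel A B k M)
    (hB : MeasurableSet B) {x : X} (hx : x ∈ A) {g : Y → ℝ} (hg : IntegrableOn g B) :
    IntegrableOn (fun y => k x y * g y) B := by
  refine Integrable.bdd_mul (c := M) hg
    (hk.measurable.comp measurable_prodMk_left).aestronglyMeasurable ?_
  exact (ae_restrict_iff' hB).mpr (Eventually.of_forall fun y hy => hk.abs_le x hx y hy)

lemma integrable_L2 (v : L2 B) : IntegrableOn v B :=
  (Lp.memLp v).integrable (by norm_num)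

lemma IsBoundedKernel.integral_exchange {k : X → Y → ℝ} {M : ℝ} (hk : IsBoundedKernel A B k M)
    (hB : MeasurableSet B) {x : X} (hx : x ∈ A) {g : Y → ℝ} (hg : IntegrableOn g B) (c₁ c₂ a : ℝ) :
    ∫ y in B, k x y * (c₁ * g y - c₂ * a)
      = c₁ * (∫ y in B, k x y * g y) - c₂ * a * ∫ y in B, k x y := by
  have h1 : IntegrableOn (fun y => k x y * g y) B := hk.integrable_mul hB hx hg
  have h2 : IntegrableOn (fun y => k x y) B := by
    simpa using hk.integrable_mul hB hx (g := fun _ => 1) (integrable_const _)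
  rw [← integral_const_mul, ← integral_const_mul, ← integral_sub (h1.const_mul _) (h2.const_mul _)]
  refine integral_congr_ae (Eventually.of_forall fun y => ?_)
  simp only []
  ring

lemma IsBoundedKernel.abs_exchange_le {k : X → Y → ℝ} {M : ℝ} (hk : IsBoundedKernel A B k M)
    (hB : MeasurableSet B) {x : X} (hx : x ∈ A) (v : L2 B) (c₁ c₂ a : ℝ) :
    |∫ y in B, k x y * (c₁ * v y - c₂ * a)|
      ≤ M * |c₁| * (√((volume.restrict B).real univ) * ‖v‖)
        + M * |c₂| * (volume.restrict B).real univ * |a| := by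
  have hv := integrable_L2 v
  rw [hk.integral_exchange hB hx hv]
  have h1 : |∫ y in B, k x y * v y| ≤ M * (√((volume.restrict B).real univ) * ‖v‖) := by
    refine abs_integral_le_integral_abs.trans (le_trans ?_
      (mul_le_mul_of_nonneg_left (integral_abs_le_mul_norm v) hk.nonneg))
    rw [← integral_const_mul]
    refine integral_mono_ae (hk.integrable_mul hB hx hv).abs (hv.abs.const_mul M) ?_
    refine (ae_restrict_iff' hB).mpr (Eventually.of_forall fun y hy => ?_)
    simp only [abs_mul]
    exact mul_le_mul_of_nonneg_right (hk.abs_le x hx y hy) (abs_nonneg _)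
  have h2 : |∫ y in B, k x y| ≤ M * (volume.restrict B).real univ := by
    rw [← Real.norm_eq_abs]
    refine norm_integral_le_of_norm_le_const (μ := volume.restrict B) ?_
    exact (ae_restrict_iff' hB).mpr (Eventually.of_forall fun y hy => hk.abs_le x hx y hy)
  calc _ ≤ |c₁ * (∫ y in B, k x y * v y)| + |c₂ * a * ∫ y in B, k x y| := abs_sub _ _
    _ = |c₁| * |∫ y in B, k x y * v y| + |c₂| * |a| * |∫ y in B, k x y| := by
      simp only [abs_mul]
    _ ≤ |c₁| * (M * (√((volume.restrict B).real univ) * ‖v‖))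
        + |c₂| * |a| * (M * (volume.restrict B).real univ) := by gcongr
    _ = _ := by ring

/-- The constant in the norm estimate of exchange operators. -/
def exchangeConst (A : Set X) (B : Set Y) (c₁ c₂ : ℝ) : ℝ :=
  |c₁| * √((volume.restrict B).real univ) * (volume.restrict A).real univ ^ (1 / (2 : ℝ))
    + |c₂| * (volume.restrict B).real univ

/-- The estimate concerns a single value w rather than an operator, so that it both makes the
operator continuous at its construction and bounds its norm. The factor M in front is what turns
uniform smallness of a kernel into smallness of the operator. -/
lemma IsExchangeOp.norm_apply_le {k : X → Y → ℝ} {M : ℝ} (hk : IsBoundedKernel A B k M)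
    (hA : MeasurableSet A) (hB : MeasurableSet B) {c₁ c₂ : ℝ} {u : L2 A} {v : L2 B} {w : L2 A}
    (hw : w =ᵐ[volume.restrict A] fun x => ∫ y in B, k x y * (c₁ * v y - c₂ * u x)) :
    ‖w‖ ≤ M * exchangeConst A B c₁ c₂ * ‖(u, v)‖ := by
  set a := M * |c₁| * (√((volume.restrict B).real univ) * ‖v‖) with ha
  set b := M * |c₂| * (volume.restrict B).real univ with hb
  have hM := hk.nonneg
  have ha0 : 0 ≤ a := by positivity
  have hb0 : 0 ≤ b := by positivity
  -- By Cauchy–Schwarz in y, |w| is dominated pointwise by a constant, from v, plus a multiple of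
  -- |u|.
  set g : L2 A := Lp.const 2 (volume.restrict A) a + b • |u| with hg
  have h1 : ‖w‖ ≤ ‖g‖ := by
    refine Lp.norm_le_norm_of_ae_le ?_
    filter_upwards [hw, Lp.coeFn_add (Lp.const 2 (volume.restrict A) a) (b • |u|),
      Lp.coeFn_const (p := 2) (μ := volume.restrict A) a, Lp.coeFn_smul b |u|, Lp.coeFn_abs u,
      ae_restrict_mem hA] with x h1 h2 h3 h4 h5 hx
    rw [h1, hg, h2, Pi.add_apply, h3, h4, Pi.smul_apply, h5, Function.const_apply, smul_eq_mul,
      Real.norm_eq_abs, Real.norm_eq_abs]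
    exact (hk.abs_exchange_le hB hx v c₁ c₂ (u x)).trans (le_abs_self _)
  have h2 : ‖g‖ ≤ a * (volume.restrict A).real univ ^ (1 / (2 : ℝ)) + b * ‖u‖ := by
    refine (norm_add_le _ _).trans (add_le_add ?_ ?_)
    · refine (Lp.norm_const_le 2 _ _).trans_eq ?_
      rw [Real.norm_of_nonneg ha0]; simp
    · rw [norm_smul, norm_abs_eq_norm, Real.norm_of_nonneg hb0]
  have h3 : ‖u‖ ≤ ‖(u, v)‖ := norm_fst_le (u, v)
  have h4 : ‖v‖ ≤ ‖(u, v)‖ := norm_snd_le (u, v)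
  calc ‖w‖ ≤ _ := h1.trans h2
    _ ≤ M * |c₁| * (√((volume.restrict B).real univ) * ‖(u, v)‖)
        * (volume.restrict A).real univ ^ (1 / (2 : ℝ)) + b * ‖(u, v)‖ := by
      rw [ha]; gcongr
    _ = _ := by rw [hb, exchangeConst]; ring

lemma IsExchangeOp.norm_le {k : X → Y → ℝ} {M : ℝ} (hk : IsBoundedKernel A B k M)
    (hA : MeasurableSet A) (hB : MeasurableSet B) {c₁ c₂ : ℝ} {L : L2 A × L2 B →L[ℝ] L2 A}
    (hL : IsExchangeOp k c₁ c₂ L) : ‖L‖ ≤ M * exchangeConst A B c₁ c₂ := by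
  refine L.opNorm_le_bound ?_ fun w => IsExchangeOp.norm_apply_le hk hA hB (hL w.1 w.2)
  have := hk.nonneg
  unfold exchangeConst
  positivity

lemma exists_isExchangeOp {k : X → Y → ℝ} {M : ℝ} (hk : IsBoundedKernel A B k M)
    (hA : MeasurableSet A) (hB : MeasurableSet B) (c₁ c₂ : ℝ) :
    ∃ L : L2 A × L2 B →L[ℝ] L2 A, IsExchangeOp k c₁ c₂ L := by
  have hmem : ∀ w : L2 A × L2 B,
      MemLp (fun x => ∫ y in B, k x y * (c₁ * w.2 y - c₂ * w.1 x)) 2 (volume.restrict A) := by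
    intro w
    have hmeas : AEStronglyMeasurable
        (fun x => ∫ y in B, k x y * (c₁ * w.2 y - c₂ * w.1 x)) (volume.restrict A) := by
      refine AEStronglyMeasurable.integral_prod_right'
        (f := fun z : X × Y => k z.1 z.2 * (c₁ * w.2 z.2 - c₂ * w.1 z.1)) ?_
      exact hk.measurable.aestronglyMeasurable.mul
        (((Lp.aestronglyMeasurable w.2).comp_snd.const_mul c₁).sub
          ((Lp.aestronglyMeasurable w.1).comp_fst.const_mul c₂))
    have hdom : ∀ a b : ℝ, MemLp (fun x => a + b * |w.1 x|) 2 (volume.restrict A) := by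
      intro a b
      have h1 : MemLp (fun x => b * |w.1 x|) 2 (volume.restrict A) :=
        (Lp.memLp w.1).abs.const_mul b
      exact (memLp_const a).add h1
    refine (hdom (M * |c₁| * (√((volume.restrict B).real univ) * ‖w.2‖))
      (M * |c₂| * (volume.restrict B).real univ)).mono' hmeas ?_
    filter_upwards [ae_restrict_mem hA] with x hx
    exact hk.abs_exchange_le hB hx w.2 c₁ c₂ (w.1 x)
  set F : L2 A × L2 B → L2 A := fun w => (hmem w).toLp with hF
  have hFae : ∀ w, F w =ᵐ[volume.restrict A]
      fun x => ∫ y in B, k x y * (c₁ * w.2 y - c₂ * w.1 x) := fun w => (hmem w).coeFn_toLp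
  clear_value F
  have hadd : ∀ w w', F (w + w') = F w + F w' := by
    intro w w'
    refine Lp.ext ?_
    filter_upwards [hFae (w + w'), hFae w, hFae w', Lp.coeFn_add (F w) (F w'),
      Lp.coeFn_add w.1 w'.1, ae_restrict_mem hA] with x h1 h2 h3 h4 h5 hx
    have h6 : ∫ y in B, k x y * (w + w').2 y = ∫ y in B, (k x y * w.2 y + k x y * w'.2 y) := by
      refine integral_congr_ae ?_
      filter_upwards [Lp.coeFn_add w.2 w'.2] with y hy
      rw [Prod.snd_add, hy, Pi.add_apply, mul_add]
    rw [h1, h4, Pi.add_apply, h2, h3, hk.integral_exchange hB hx (integrable_L2 _),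
      hk.integral_exchange hB hx (integrable_L2 _),
      hk.integral_exchange hB hx (integrable_L2 _), h6,
      integral_add (hk.integrable_mul hB hx (integrable_L2 _))
        (hk.integrable_mul hB hx (integrable_L2 _)), Prod.fst_add, h5, Pi.add_apply]
    ring
  have hsmul : ∀ (r : ℝ) w, F (r • w) = r • F w := by
    intro r w
    refine Lp.ext ?_
    filter_upwards [hFae (r • w), hFae w, Lp.coeFn_smul r (F w), Lp.coeFn_smul r w.1,
      ae_restrict_mem hA] with x h1 h2 h4 h5 hx
    have h6 : ∫ y in B, k x y * (r • w).2 y = ∫ y in B, r * (k x y * w.2 y) := by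
      refine integral_congr_ae ?_
      filter_upwards [Lp.coeFn_smul r w.2] with y hy
      rw [Prod.smul_snd, hy, Pi.smul_apply, smul_eq_mul]
      ring
    rw [h1, h4, Pi.smul_apply, h2, hk.integral_exchange hB hx (integrable_L2 _),
      hk.integral_exchange hB hx (integrable_L2 _), h6, integral_const_mul,
      Prod.smul_fst, h5, Pi.smul_apply, smul_eq_mul, smul_eq_mul]
    ring
  let L : L2 A × L2 B →ₗ[ℝ] L2 A := ⟨⟨F, hadd⟩, hsmul⟩
  exact ⟨L.mkContinuous (M * exchangeConst A B c₁ c₂) fun w =>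
    IsExchangeOp.norm_apply_le hk hA hB (hFae w), fun u v => hFae (u, v)⟩

lemma IsExchangeOp.sub {k k' : X → Y → ℝ} {M M' : ℝ} (hk : IsBoundedKernel A B k M)
    (hk' : IsBoundedKernel A B k' M') (hA : MeasurableSet A) (hB : MeasurableSet B) {c₁ c₂ : ℝ}
    {L L' : L2 A × L2 B →L[ℝ] L2 A} (hL : IsExchangeOp k c₁ c₂ L)
    (hL' : IsExchangeOp k' c₁ c₂ L') :
    IsExchangeOp (fun x y => k x y - k' x y) c₁ c₂ (L - L') := by
  intro u v
  rw [sub_apply]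
  filter_upwards [hL u v, hL' u v, Lp.coeFn_sub (L (u, v)) (L' (u, v)), ae_restrict_mem hA]
    with x h1 h2 h3 hx
  have hi : IntegrableOn (fun y => c₁ * v y - c₂ * u x) B :=
    ((integrable_L2 v).const_mul c₁).sub (integrable_const _)
  rw [h3, Pi.sub_apply, h1, h2, ← integral_sub (hk.integrable_mul hB hx hi)
    (hk'.integrable_mul hB hx hi)]
  refine integral_congr_ae (Eventually.of_forall fun y => ?_)
  simp only []
  ring

/-- The difference of two exchange operators with the same constants has the difference of the
kernels as its kernel, so its norm is at most the supremum of that difference times a fixed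
constant. -/
lemma tendsto_exchangeOp (hA : MeasurableSet A) (hB : MeasurableSet B) {Z : Type*} {l : Filter Z}
    {k : Z → X → Y → ℝ} {k₀ : X → Y → ℝ} {M : Z → ℝ} {M₀ : ℝ}
    (hk : ∀ ε, IsBoundedKernel A B (k ε) (M ε)) (hk₀ : IsBoundedKernel A B k₀ M₀)
    (hlim : ∀ δ > 0, ∀ᶠ ε in l, ∀ x ∈ A, ∀ y ∈ B, |k ε x y - k₀ x y| ≤ δ) {c₁ c₂ : ℝ}
    {L : Z → L2 A × L2 B →L[ℝ] L2 A} {L₀ : L2 A × L2 B →L[ℝ] L2 A}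
    (hL : ∀ ε, IsExchangeOp (k ε) c₁ c₂ (L ε)) (hL₀ : IsExchangeOp k₀ c₁ c₂ L₀) :
    Tendsto L l (𝓝 L₀) := by
  rw [tendsto_iff_norm_sub_tendsto_zero, Metric.tendsto_nhds]
  intro η hη
  set D := |exchangeConst A B c₁ c₂| + 1
  have hD : 0 < D := by positivity
  filter_upwards [hlim (η / 2 / D) (by positivity)] with ε hε
  have hb : IsBoundedKernel A B (fun x y => k ε x y - k₀ x y) (η / 2 / D) :=
    ⟨(hk ε).measurable.sub hk₀.measurable, by positivity, hε⟩
  have h1 := ((hL ε).sub (hk ε) hk₀ hA hB hL₀).norm_le hb hA hB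
  have h2 : η / 2 / D * exchangeConst A B c₁ c₂ ≤ η / 2 / D * D := by
    gcongr
    exact (le_abs_self _).trans (by simp [D])
  rw [div_mul_cancel₀ _ hD.ne'] at h2
  rw [Real.dist_0_eq_abs, abs_norm]
  linarith

end ExchangeOperators

/-! ### Continuous kernels on bounded sets -/

section ContinuousKernels

variable {X Y : Type*} [PseudoMetricSpace X] [ProperSpace X] [PseudoMetricSpace Y]
  [ProperSpace Y] [MeasureSpace X] [MeasureSpace Y] [BorelSpace X] [BorelSpace Y]
  {A : Set X} {B : Set Y}

lemma exists_isBoundedKernel (hA : Bornology.IsBounded A) (hB : Bornology.IsBounded B)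
    {k : X → Y → ℝ} (hk : Continuous (Function.uncurry k)) : ∃ M, IsBoundedKernel A B k M := by
  have hc : IsCompact (closure A ×ˢ closure B) := hA.isCompact_closure.prod hB.isCompact_closure
  obtain ⟨M, hM⟩ := hc.exists_bound_of_continuousOn hk.continuousOn
  refine ⟨|M|, hk.measurable, abs_nonneg _, fun x hx y hy => ?_⟩
  exact (hM (x, y) ⟨subset_closure hx, subset_closure hy⟩).trans (le_abs_self M)

/-- Joint continuity at ε = 0 becomes uniform over the compact product of the closures. -/
lemma eventually_abs_kernel_sub_le (hA : Bornology.IsBounded A) (hB : Bornology.IsBounded B)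
    {k : ℝ → X → Y → ℝ} (hk : Continuous fun p : ℝ × X × Y => k p.1 p.2.1 p.2.2) {δ : ℝ}
    (hδ : 0 < δ) : ∀ᶠ ε in 𝓝[>] (0 : ℝ), ∀ x ∈ A, ∀ y ∈ B, |k ε x y - k 0 x y| ≤ δ := by
  have hc : IsCompact (closure A ×ˢ closure B) := hA.isCompact_closure.prod hB.isCompact_closure
  have h := hc.eventually_forall_of_forall_eventually (x₀ := (0 : ℝ))
    (P := fun ε z => |k ε z.1 z.2 - k 0 z.1 z.2| < δ) fun z _ => by
      have hcont : Continuous fun p : ℝ × X × Y =>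
          |k p.1 p.2.1 p.2.2 - k 0 p.2.1 p.2.2| := by
        have h0 : Continuous fun p : ℝ × X × Y => k 0 p.2.1 p.2.2 :=
          hk.comp (continuous_const.prodMk continuous_snd)
        exact (hk.sub h0).abs
      exact hcont.continuousAt.eventually_lt continuousAt_const (by simpa using hδ)
  filter_upwards [nhdsWithin_le_nhds h] with ε hε x hx y hy
  exact (hε (x, y) ⟨subset_closure hx, subset_closure hy⟩).le

end ContinuousKernels

/-! ### Integration over the transversal section R₂ -/

section Transversal

variable {N₁ N₂ : ℕ} {R₁ : Set (E N₁)} {R₂ : Set (E N₂)}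

lemma volume_restrict_prod (R₁ : Set (E N₁)) (R₂ : Set (E N₂)) :
    (volume : Measure (E N₁ × E N₂)).restrict (R₁ ×ˢ R₂)
      = (volume.restrict R₁).prod (volume.restrict R₂) := by
  rw [Measure.volume_eq_prod, Measure.prod_restrict]

lemma ae_ae_of_ae_restrict_prod {P : E N₁ × E N₂ → Prop}
    (h : ∀ᵐ z ∂(volume.restrict (R₁ ×ˢ R₂)), P z) :
    ∀ᵐ x₁ ∂(volume.restrict R₁), ∀ᵐ x₂ ∂(volume.restrict R₂), P (x₁, x₂) := by
  rw [volume_restrict_prod] at h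
  exact Measure.ae_ae_of_ae_prod h

lemma integrable_prod_of_integrableOn {g : E N₁ × E N₂ → ℝ} (hg : IntegrableOn g (R₁ ×ˢ R₂)) :
    Integrable g ((volume.restrict R₁).prod (volume.restrict R₂)) := by
  rwa [IntegrableOn, volume_restrict_prod] at hg

lemma setIntegral_prod_eq {g : E N₁ × E N₂ → ℝ} (hg : IntegrableOn g (R₁ ×ˢ R₂)) :
    ∫ z in R₁ ×ˢ R₂, g z = ∫ x₁ in R₁, ∫ x₂ in R₂, g (x₁, x₂) := by
  rw [volume_restrict_prod, integral_prod _ (integrable_prod_of_integrableOn hg)]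

variable (hR₂ : Bornology.IsBounded R₂)

lemma transversalIntegral_coeFn (f : L2 (R₁ ×ˢ R₂)) :
    transversalIntegral hR₂ f =ᵐ[volume.restrict R₁] fun x₁ => ∫ x₂ in R₂, f (x₁, x₂) :=
  (memLp_transversalIntegral hR₂ f).coeFn_toLp

lemma ae_integrable_slice (hR₁ : Bornology.IsBounded R₁) (hR₂ : Bornology.IsBounded R₂)
    (f : L2 (R₁ ×ˢ R₂)) :
    ∀ᵐ x₁ ∂(volume.restrict R₁), Integrable (fun x₂ => f (x₁, x₂)) (volume.restrict R₂) := by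
  have : IsFiniteMeasure ((volume : Measure (E N₁ × E N₂)).restrict (R₁ ×ˢ R₂)) :=
    isFiniteMeasure_restrict.mpr (hR₁.prod hR₂).measure_lt_top.ne
  exact (integrable_prod_of_integrableOn (integrable_L2 f)).prod_right_ae

lemma norm_transversalIntegral_le (f : L2 (R₁ ×ˢ R₂)) :
    ‖transversalIntegral hR₂ f‖ ≤ √((volume.restrict R₂).real univ) * ‖f‖ := by
  have hfin : IsFiniteMeasure (volume.restrict R₂) :=
    isFiniteMeasure_restrict.mpr hR₂.measure_lt_top.ne
  refine le_of_sq_le_sq ?_ (by positivity)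
  rw [mul_pow, Real.sq_sqrt measureReal_nonneg, L2_norm_sq, L2_norm_sq,
    setIntegral_prod_eq (Lp.memLp f).integrable_sq]
  have hf : MemLp f 2 ((volume.restrict R₁).prod (volume.restrict R₂)) := by
    rw [← volume_restrict_prod]; exact Lp.memLp f
  have hsq : Integrable (fun z => f z ^ 2) ((volume.restrict R₁).prod (volume.restrict R₂)) :=
    hf.integrable_sq
  rw [← integral_const_mul]
  refine integral_mono_ae (Lp.memLp _).integrable_sq (hsq.integral_prod_left.const_mul _) ?_
  filter_upwards [hsq.prod_right_ae, hf.1.prodMk_left, transversalIntegral_coeFn hR₂ f]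
    with x hx hmx h
  rw [h]
  exact sq_integral_le _ ((memLp_two_iff_integrable_sq hmx).mpr hx)

/-- The transversal integral as a bounded operator. -/
def transversalL (hR₁ : Bornology.IsBounded R₁) (hR₂ : Bornology.IsBounded R₂) :
    L2 (R₁ ×ˢ R₂) →L[ℝ] L2 R₁ :=
  LinearMap.mkContinuous
    { toFun := transversalIntegral hR₂
      map_add' := by
        intro f g
        refine Lp.ext ?_
        filter_upwards [transversalIntegral_coeFn hR₂ (f + g), transversalIntegral_coeFn hR₂ f,
          transversalIntegral_coeFn hR₂ g,
          Lp.coeFn_add (transversalIntegral hR₂ f) (transversalIntegral hR₂ g),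
          ae_ae_of_ae_restrict_prod (Lp.coeFn_add f g), ae_integrable_slice hR₁ hR₂ f,
          ae_integrable_slice hR₁ hR₂ g] with x h1 h2 h3 h4 h5 hf hg
        rw [h1, h4, Pi.add_apply, h2, h3, ← integral_add hf hg]
        exact integral_congr_ae h5
      map_smul' := by
        intro c f
        refine Lp.ext ?_
        filter_upwards [transversalIntegral_coeFn hR₂ (c • f), transversalIntegral_coeFn hR₂ f,
          Lp.coeFn_smul c (transversalIntegral hR₂ f),
          ae_ae_of_ae_restrict_prod (Lp.coeFn_smul c f)] with x h1 h2 h4 h5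
        rw [RingHom.id_apply, h1, h4, Pi.smul_apply, h2, smul_eq_mul, ← integral_const_mul]
        exact integral_congr_ae h5 }
    (√((volume.restrict R₂).real univ)) (norm_transversalIntegral_le hR₂)

/-- If the kernel does not depend on the transversal part of the integration variable, an
exchange operator acts on the transversal integral. -/
lemma IsExchangeOp.apply_transversal_right {X : Type*} [MeasureSpace X] {A : Set X}
    [IsFiniteMeasure (volume.restrict A)] (hA : MeasurableSet A) (hR₁o : MeasurableSet R₁)
    (hR₂o : MeasurableSet R₂) (hR₁ : Bornology.IsBounded R₁) (hR₂ : Bornology.IsBounded R₂)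
    {k : X → E N₁ → ℝ} {M : ℝ} (hk : IsBoundedKernel A R₁ k M) {c₁ c₂ : ℝ}
    {L : L2 A × L2 (R₁ ×ˢ R₂) →L[ℝ] L2 A} {L' : L2 A × L2 R₁ →L[ℝ] L2 A}
    (hL : IsExchangeOp (fun x y => k x y.1) c₁ c₂ L)
    (hL' : IsExchangeOp k c₁ (volume.real R₂ * c₂) L') (u : L2 A) (v : L2 (R₁ ×ˢ R₂)) :
    L (u, v) = L' (u, transversalIntegral hR₂ v) := by
  have : IsFiniteMeasure ((volume : Measure (E N₁ × E N₂)).restrict (R₁ ×ˢ R₂)) :=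
    isFiniteMeasure_restrict.mpr (hR₁.prod hR₂).measure_lt_top.ne
  have : IsFiniteMeasure (volume.restrict R₁) :=
    isFiniteMeasure_restrict.mpr hR₁.measure_lt_top.ne
  have : IsFiniteMeasure (volume.restrict R₂) :=
    isFiniteMeasure_restrict.mpr hR₂.measure_lt_top.ne
  have hk' : IsBoundedKernel A (R₁ ×ˢ R₂) (fun x y => k x y.1) M :=
    ⟨hk.measurable.comp (measurable_fst.prodMk (measurable_fst.comp measurable_snd)), hk.nonneg,
      fun x hx y hy => hk.abs_le x hx y.1 hy.1⟩
  refine Lp.ext ?_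
  filter_upwards [hL u v, hL' u (transversalIntegral hR₂ v), ae_restrict_mem hA] with x h1 h2 hx
  have hi : IntegrableOn (fun y => k x y.1 * (c₁ * v y - c₂ * u x)) (R₁ ×ˢ R₂) :=
    hk'.integrable_mul (hR₁o.prod hR₂o) hx
      (((integrable_L2 v).const_mul c₁).sub (integrable_const _))
  rw [h1, h2, setIntegral_prod_eq hi]
  refine integral_congr_ae ?_
  filter_upwards [ae_integrable_slice hR₁ hR₂ v, transversalIntegral_coeFn hR₂ v] with y hy hy2
  rw [integral_const_mul, integral_sub (hy.const_mul c₁) (integrable_const _), integral_const_mul,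
    hy2, integral_const, measureReal_restrict_apply_univ, smul_eq_mul]
  ring

/-- If the kernel does not depend on the transversal part of the outer variable, the transversal
integral of the exchange operator is an exchange operator of the transversal integral. -/
lemma IsExchangeOp.transversal_apply {Y : Type*} [MeasureSpace Y] {B : Set Y}
    [IsFiniteMeasure (volume.restrict B)] (hB : MeasurableSet B) (hR₁o : MeasurableSet R₁)
    (hR₁ : Bornology.IsBounded R₁) (hR₂ : Bornology.IsBounded R₂)
    {k : E N₁ → Y → ℝ} {M : ℝ} (hk : IsBoundedKernel R₁ B k M) {c₁ c₂ : ℝ}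
    {L : L2 (R₁ ×ˢ R₂) × L2 B →L[ℝ] L2 (R₁ ×ˢ R₂)} {L' : L2 R₁ × L2 B →L[ℝ] L2 R₁}
    (hL : IsExchangeOp (fun x y => k x.1 y) c₁ c₂ L)
    (hL' : IsExchangeOp k (volume.real R₂ * c₁) c₂ L') (v : L2 (R₁ ×ˢ R₂)) (w : L2 B) :
    transversalIntegral hR₂ (L (v, w)) = L' (transversalIntegral hR₂ v, w) := by
  have : IsFiniteMeasure (volume.restrict R₁) :=
    isFiniteMeasure_restrict.mpr hR₁.measure_lt_top.ne
  have : IsFiniteMeasure (volume.restrict R₂) :=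
    isFiniteMeasure_restrict.mpr hR₂.measure_lt_top.ne
  refine Lp.ext ?_
  filter_upwards [transversalIntegral_coeFn hR₂ (L (v, w)), transversalIntegral_coeFn hR₂ v,
    hL' (transversalIntegral hR₂ v) w, ae_ae_of_ae_restrict_prod (hL v w),
    ae_integrable_slice hR₁ hR₂ v, ae_restrict_mem hR₁o] with x h1 h2 h3 h4 hv hx
  have h5 : ∀ᵐ x₂ ∂(volume.restrict R₂), L (v, w) (x, x₂)
      = c₁ * (∫ y in B, k x y * w y) - (c₂ * ∫ y in B, k x y) * v (x, x₂) := by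
    filter_upwards [h4] with x₂ h
    rw [h, hk.integral_exchange hB hx (integrable_L2 w)]
    ring
  rw [h1, h3, h2, hk.integral_exchange hB hx (integrable_L2 w), integral_congr_ae h5,
    integral_sub (integrable_const _) (hv.const_mul _), integral_const, integral_const_mul,
    measureReal_restrict_apply_univ, smul_eq_mul]
  ring

end Transversal

/-! ### Weak solutions of the system and abstract coupled solutions -/

section Translation

variable {N₁ N₂ : ℕ} {Ω : Set (E N₁ × E N₂)} {Y : Type*} [MeasureSpace Y] {S : Set Y}

/-- The coupling operator of the system, assembled from exchange operators. -/
def couplingOp (c : ℝ) (L₁ : L2 Ω × L2 S →L[ℝ] L2 Ω) (L₂ : L2 S × L2 S →L[ℝ] L2 S)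
    (L₃ : L2 S × L2 Ω →L[ℝ] L2 S) : L2 Ω × L2 S →L[ℝ] L2 Ω × L2 S :=
  L₁.prod (c • L₂.comp ((ContinuousLinearMap.snd ℝ (L2 Ω) (L2 S)).prod
      (ContinuousLinearMap.snd ℝ (L2 Ω) (L2 S)))
    + L₃.comp ((ContinuousLinearMap.snd ℝ (L2 Ω) (L2 S)).prod
      (ContinuousLinearMap.fst ℝ (L2 Ω) (L2 S))))

lemma couplingOp_apply (c : ℝ) (L₁ : L2 Ω × L2 S →L[ℝ] L2 Ω) (L₂ : L2 S × L2 S →L[ℝ] L2 S)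
    (L₃ : L2 S × L2 Ω →L[ℝ] L2 S) (u : L2 Ω) (v : L2 S) :
    couplingOp c L₁ L₂ L₃ (u, v) = (L₁ (u, v), c • L₂ (v, v) + L₃ (v, u)) := rfl

lemma tendsto_couplingOp (c : ℝ) {l : Filter ℝ} {L₁ : ℝ → L2 Ω × L2 S →L[ℝ] L2 Ω}
    {L₂ : ℝ → L2 S × L2 S →L[ℝ] L2 S} {L₃ : ℝ → L2 S × L2 Ω →L[ℝ] L2 S}
    {M₁ : L2 Ω × L2 S →L[ℝ] L2 Ω} {M₂ : L2 S × L2 S →L[ℝ] L2 S}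
    {M₃ : L2 S × L2 Ω →L[ℝ] L2 S} (h₁ : Tendsto L₁ l (𝓝 M₁)) (h₂ : Tendsto L₂ l (𝓝 M₂))
    (h₃ : Tendsto L₃ l (𝓝 M₃)) :
    Tendsto (fun ε => couplingOp c (L₁ ε) (L₂ ε) (L₃ ε)) l (𝓝 (couplingOp c M₁ M₂ M₃)) := by
  have hc : Continuous fun q : (L2 Ω × L2 S →L[ℝ] L2 Ω) × (L2 S × L2 S →L[ℝ] L2 S)
      × (L2 S × L2 Ω →L[ℝ] L2 S) => couplingOp c q.1 q.2.1 q.2.2 := by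
    refine (ContinuousLinearMap.prodₗᵢ ℝ).continuous.comp (continuous_fst.prodMk ?_)
    exact ((continuous_snd.fst.clm_comp continuous_const).const_smul c).add
      (continuous_snd.snd.clm_comp continuous_const)
  exact (hc.tendsto (M₁, M₂, M₃)).comp (h₁.prodMk_nhds (h₂.prodMk_nhds h₃))

lemma integral_mul_eq_inner {α : Type*} [MeasurableSpace α] {μ : Measure α} {g : α → ℝ}
    {f φ : Lp ℝ 2 μ} (h : f =ᵐ[μ] g) : ∫ x, g x * φ x ∂μ = inner ℝ f φ := by
  rw [L2.inner_def]
  refine integral_congr_ae ?_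
  filter_upwards [h] with x hx
  simp [hx, mul_comm]

lemma setIntegral_Ioo_eq {T : ℝ} (hT : 0 ≤ T) (g : ℝ → ℝ) :
    ∫ t in Ioo 0 T, g t = ∫ t in (0)..T, g t := by
  rw [intervalIntegral.integral_of_le hT, integral_Ioc_eq_integral_Ioo]

lemma intervalIntegral_congr_of_nonneg {F : Type*} [NormedAddCommGroup F] [NormedSpace ℝ F]
    {T : ℝ} (hT : 0 ≤ T) {f g : ℝ → F} (h : ∀ t, 0 ≤ t → f t = g t) :
    ∫ t in (0)..T, f t = ∫ t in (0)..T, g t := by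
  refine intervalIntegral.integral_congr fun s hs => ?_
  rw [uIcc_of_le hT] at hs
  exact h s hs.1

variable {c : ℝ} {J : Y → Y → ℝ} {K : E N₁ × E N₂ → Y → ℝ} {K' : Y → E N₁ × E N₂ → ℝ}
  {L₁ : L2 Ω × L2 S →L[ℝ] L2 Ω} {L₂ : L2 S × L2 S →L[ℝ] L2 S} {L₃ : L2 S × L2 Ω →L[ℝ] L2 S}

lemma exists_continuous_eq_of_nonneg {X : Type*} [TopologicalSpace X] {u : ℝ → X}
    (hu : ContinuousOn u (Ici 0)) : ∃ U : ℝ → X, Continuous U ∧ ∀ t, 0 ≤ t → U t = u t :=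
  ⟨fun t => u (max t 0), continuous_comp_max_zero hu, fun t ht => by simp [ht]⟩

lemma IsExchangeOp.integral_source_mul (h₁ : IsExchangeOp K 1 c L₁) (u : L2 Ω) (v : L2 S)
    (φ : L2 Ω) :
    ∫ x in Ω, (∫ y in S, K x y * (v y - c * u x)) * φ x
      = inner ℝ (couplingOp c L₁ L₂ L₃ (u, v)).1 φ := by
  have h := h₁ u v
  simp only [one_mul] at h
  exact integral_mul_eq_inner h

lemma IsExchangeOp.integral_nonlocal_mul (h₂ : IsExchangeOp J 1 1 L₂) (v ψ : L2 S) :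
    ∫ x in S, (c * ∫ y in S, J x y * (v y - v x)) * ψ x = c * inner ℝ (L₂ (v, v)) ψ := by
  have h := h₂ v v
  simp only [one_mul] at h
  rw [← integral_mul_eq_inner h, ← integral_const_mul]
  refine integral_congr_ae (Eventually.of_forall fun x => ?_)
  simp only [mul_assoc]

lemma IsExchangeOp.integral_absorption_mul (h₃ : IsExchangeOp K' c 1 L₃) (u : L2 Ω) (v ψ : L2 S) :
    ∫ x in S, (∫ y in Ω, K' x y * (v x - c * u y)) * ψ x = - inner ℝ (L₃ (v, u)) ψ := by
  have h := h₃ v u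
  rw [← integral_mul_eq_inner h, ← integral_neg]
  refine integral_congr_ae (Eventually.of_forall fun x => ?_)
  simp only []
  rw [← neg_mul, ← integral_neg]
  congr 2
  funext y
  ring

lemma IsExchangeOp.setIntegral_coupling_snd (h₂ : IsExchangeOp J 1 1 L₂)
    (h₃ : IsExchangeOp K' c 1 L₃) {u : ℝ → L2 Ω} {v ψ : ℝ → L2 S} (hu : ContinuousOn u (Ici 0))
    (hv : ContinuousOn v (Ici 0)) (hψ : Continuous ψ) {T : ℝ} (hT : 0 ≤ T) :
    (∫ t in Ioo 0 T, ∫ x in S, (c * ∫ y in S, J x y * (v t y - v t x)) * ψ t x)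
      - (∫ t in Ioo 0 T, ∫ x in S, (∫ y in Ω, K' x y * (v t x - c * u t y)) * ψ t x)
      = ∫ t in (0)..T, inner ℝ (couplingOp c L₁ L₂ L₃ (u t, v t)).2 (ψ t) := by
  obtain ⟨U, hU, hUu⟩ := exists_continuous_eq_of_nonneg hu
  obtain ⟨W, hW, hWv⟩ := exists_continuous_eq_of_nonneg hv
  simp_rw [h₂.integral_nonlocal_mul, h₃.integral_absorption_mul]
  rw [setIntegral_Ioo_eq hT, setIntegral_Ioo_eq hT]
  rw [intervalIntegral_congr_of_nonneg hT (f := fun t => c * inner ℝ (L₂ (v t, v t)) (ψ t))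
      (g := fun t => c * inner ℝ (L₂ (W t, W t)) (ψ t)) (fun t ht => by rw [hWv t ht]),
    intervalIntegral_congr_of_nonneg hT (f := fun t => -inner ℝ (L₃ (v t, u t)) (ψ t))
      (g := fun t => - inner ℝ (L₃ (W t, U t)) (ψ t))
      (fun t ht => by rw [hWv t ht, hUu t ht]),
    ← intervalIntegral.integral_sub (Continuous.intervalIntegrable (by fun_prop) _ _)
      (Continuous.intervalIntegrable (by fun_prop) _ _)]
  refine intervalIntegral_congr_of_nonneg hT fun t ht => ?_
  rw [hWv t ht, hUu t ht, couplingOp_apply, inner_add_left, real_inner_smul_left]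
  ring

/-- Test functions constant in time are enough: the term with the time derivative disappears, and
for w in the domain of L the gradient term becomes an L² product with L w. -/
lemma IsWeakSolution.isCoupledSolution (h₁ : IsExchangeOp K 1 c L₁) (h₂ : IsExchangeOp J 1 1 L₂)
    (h₃ : IsExchangeOp K' c 1 L₃) {u₀ : L2 Ω} {v₀ : L2 S} {u : ℝ → L2 Ω} {v : ℝ → L2 S}
    (h : IsWeakSolution Ω S c J K K' u₀ v₀ u v) {U : ℝ → L2 Ω} {W : ℝ → L2 S}
    (hU : Continuous U) (hW : Continuous W) (hUu : ∀ t, 0 ≤ t → U t = u t)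
    (hWv : ∀ t, 0 ≤ t → W t = v t) :
    IsCoupledSolution (embed Ω) (couplingOp c L₁ L₂ L₃) u₀ v₀ U W := by
  have hAc : Continuous fun s => couplingOp c L₁ L₂ L₃ (U s, W s) :=
    (couplingOp c L₁ L₂ L₃).continuous.comp (hU.prodMk hW)
  refine ⟨hU, hW, ?_, ?_⟩
  · intro w z hwz t ht
    rcases ht.eq_or_lt with rfl | ht0
    · simp [hUu 0 le_rfl, h.initial_u]
    obtain ⟨p, hp, hpu, hweak⟩ := h.weak_u
    have h1 := hweak t ht0 (fun _ => w) contDiff_const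
    simp only [deriv_const] at h1
    have e0 : ∀ s : ℝ, inner ℝ (u s) (fnOf (0 : H1 Ω)) = 0 := fun s => by
      rw [← embed_apply, map_zero, inner_zero_right]
    -- The identity defining z = L w is used with `p s` itself as the test element.
    have e1 : ∫ s in Ioo 0 t, inner ℝ (gradOf (p s)) (gradOf w)
        = ∫ s in Ioo 0 t, inner ℝ (u s) z := by
      refine integral_congr_ae ?_
      filter_upwards [ae_restrict_of_ae_restrict_of_subset Ioo_subset_Ioi_self hpu] with s hs
      rw [inner_gradOf, real_inner_comm, real_inner_comm (fnOf w)]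
      refine (hwz (p s)).trans ?_
      rw [embed_apply, hs, real_inner_comm]
    simp_rw [e0] at h1
    simp_rw [h₁.integral_source_mul (L₂ := L₂) (L₃ := L₃)] at h1
    rw [e1, setIntegral_Ioo_eq ht, setIntegral_Ioo_eq ht, setIntegral_Ioo_eq ht,
      intervalIntegral.integral_zero, sub_zero] at h1
    rw [intervalIntegral.integral_sub
      ((hAc.fst.inner continuous_const).intervalIntegrable _ _)
      ((hU.inner continuous_const).intervalIntegrable _ _), hUu t ht, embed_apply, h1,
      intervalIntegral_congr_of_nonneg ht (f := fun s => inner ℝ (U s) z)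
        (g := fun s => inner ℝ (u s) z) (fun s hs => by rw [hUu s hs]),
      intervalIntegral_congr_of_nonneg ht
        (f := fun s => inner ℝ (couplingOp c L₁ L₂ L₃ (U s, W s)).1 (fnOf w))
        (g := fun s => inner ℝ (couplingOp c L₁ L₂ L₃ (u s, v s)).1 (fnOf w))
        (fun s hs => by rw [hUu s hs, hWv s hs])]
    ring
  · intro t ht
    rcases ht.eq_or_lt with rfl | ht0
    · simp [hWv 0 le_rfl, h.initial_v]
    refine ext_inner_right ℝ fun y => ?_
    have h1 := h.weak_v t ht0 (fun _ => y) contDiff_const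
    simp only [deriv_const, inner_zero_right, integral_zero, sub_zero] at h1
    rw [add_sub_assoc, h₂.setIntegral_coupling_snd (L₁ := L₁) h₃ h.continuousOn_u
      h.continuousOn_v continuous_const ht] at h1
    rw [inner_add_left, real_inner_comm y (intervalIntegral _ _ _ _), ← innerSL_apply_apply ℝ y,
      ← ContinuousLinearMap.intervalIntegral_comp_comm _
        (hAc.snd.intervalIntegrable _ _), hWv t ht, h1]
    congr 1
    refine intervalIntegral_congr_of_nonneg ht fun s hs => ?_
    rw [hUu s hs, hWv s hs, innerSL_apply_apply, real_inner_comm]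

lemma integral_inner_deriv_of_eq_integral {F : Type*} [NormedAddCommGroup F]
    [InnerProductSpace ℝ F] [CompleteSpace F] {v₀ : F} {v g ψ : ℝ → F} (hg : Continuous g)
    (hv : ∀ t, 0 ≤ t → v t = v₀ + ∫ s in (0)..t, g s) (hψ : ContDiff ℝ 1 ψ) {T : ℝ} (hT : 0 ≤ T) :
    inner ℝ (v T) (ψ T) - ∫ t in (0)..T, inner ℝ (v t) (deriv ψ t)
      = inner ℝ v₀ (ψ 0) + ∫ t in (0)..T, inner ℝ (g t) (ψ t) := by
  have hd := hasDerivAt_const_add_integral v₀ hg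
  have hψd : ∀ t, HasDerivAt ψ (deriv ψ t) t := fun t =>
    (hψ.differentiable one_ne_zero).differentiableAt.hasDerivAt
  have hψ' : Continuous (deriv ψ) := hψ.continuous_deriv le_rfl
  have hψc : Continuous ψ := hψ.continuous
  have hcont : Continuous (fun t => v₀ + ∫ s in (0)..t, g s) :=
    continuous_iff_continuousAt.mpr fun t => (hd t).continuousAt
  have hftc := intervalIntegral.integral_eq_sub_of_hasDerivAt (a := 0) (b := T)
    (fun s _ => (hd s).inner ℝ (hψd s)) (Continuous.intervalIntegrable (by fun_prop) _ _)
  rw [intervalIntegral.integral_add (Continuous.intervalIntegrable (by fun_prop) _ _)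
    (Continuous.intervalIntegrable (by fun_prop) _ _), intervalIntegral.integral_same, add_zero,
    ← hv T hT] at hftc
  rw [intervalIntegral_congr_of_nonneg hT (f := fun t => inner ℝ (v t) (deriv ψ t))
    (g := fun t => inner ℝ (v₀ + ∫ s in (0)..t, g s) (deriv ψ t))
    (fun t ht => by rw [hv t ht])]
  linarith

lemma memLp_Ioo_of_continuousOn {F : Type*} [NormedAddCommGroup F] {p : ℝ → F}
    (hp : ContinuousOn p (Ici 0)) (q : ℝ≥0∞) (T : ℝ) :
    MemLp p q (volume.restrict (Ioo 0 T)) := by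
  have hp' : ContinuousOn p (Icc 0 T) := hp.mono fun t ht => ht.1
  obtain ⟨C, hC⟩ := isCompact_Icc.exists_bound_of_continuousOn hp'
  refine MemLp.of_bound ((hp'.mono Ioo_subset_Icc_self).aestronglyMeasurable measurableSet_Ioo) C ?_
  filter_upwards [ae_restrict_mem measurableSet_Ioo] with t ht
  exact hC t ⟨ht.1.le, ht.2.le⟩

/-- The continuous H¹-valued lift p supplies the gradient in the weak formulation. The hypothesis on
`u 0` is separate because the very weak equation fixes the initial value only through inner
products. -/
lemma IsCoupledSolution.isWeakSolution (hinj : Function.Injective (embed Ω))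
    (h₁ : IsExchangeOp K 1 c L₁) (h₂ : IsExchangeOp J 1 1 L₂)
    (h₃ : IsExchangeOp K' c 1 L₃) {u₀ : L2 Ω} {v₀ : L2 S} {u : ℝ → L2 Ω} {v : ℝ → L2 S}
    (h : IsCoupledSolution (embed Ω) (couplingOp c L₁ L₂ L₃) u₀ v₀ u v) (h0 : u 0 = u₀)
    {p : ℝ → H1 Ω} (hp : ContinuousOn p (Ici 0)) (hpu : ∀ t, 0 ≤ t → embed Ω (p t) = u t) :
    IsWeakSolution Ω S c J K K' u₀ v₀ (fun t => fnOf (p t)) v := by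
  have hu := h.continuous_u
  have hv := h.continuous_v
  have hfc : ContinuousOn (fun t => fnOf (p t)) (Ici 0) :=
    (embed Ω).continuous.comp_continuousOn hp
  refine ⟨hfc, hv.continuousOn, (hpu 0 le_rfl).trans h0, by simpa using h.eq_v 0 le_rfl,
    ⟨p, fun T _ => memLp_Ioo_of_continuousOn hp 2 T, Eventually.of_forall fun t => rfl, ?_⟩, ?_⟩
  · intro T hT φ hφ
    have h1 := h.eq_u.weak_form hinj (by fun_prop) hp hpu hφ hT.le
    simp_rw [h₁.integral_source_mul (L₂ := L₂) (L₃ := L₃), inner_gradOf]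
    rw [setIntegral_Ioo_eq hT.le, setIntegral_Ioo_eq hT.le, setIntegral_Ioo_eq hT.le]
    have hpu' : ∀ t, 0 ≤ t → fnOf (p t) = u t := hpu
    rw [hpu' T hT.le, intervalIntegral_congr_of_nonneg hT.le
      (f := fun t => inner ℝ (fnOf (p t)) (fnOf (deriv φ t)))
      (g := fun t => inner ℝ (u t) (embed Ω (deriv φ t)))
      (fun t ht => by rw [hpu' t ht, embed_apply]),
      intervalIntegral_congr_of_nonneg hT.le
      (f := fun t => inner ℝ (couplingOp c L₁ L₂ L₃ (fnOf (p t), v t)).1 (fnOf (φ t)))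
      (g := fun t => inner ℝ (couplingOp c L₁ L₂ L₃ (u t, v t)).1 (embed Ω (φ t)))
      (fun t ht => by rw [hpu' t ht, embed_apply])]
    exact h1
  · intro T hT ψ hψ
    rw [add_sub_assoc, h₂.setIntegral_coupling_snd (L₁ := L₁) h₃ hfc hv.continuousOn
      hψ.continuous hT.le, setIntegral_Ioo_eq hT.le,
      integral_inner_deriv_of_eq_integral (by fun_prop) h.eq_v hψ hT.le]
    congr 1
    refine intervalIntegral_congr_of_nonneg hT.le fun t ht => ?_
    rw [show fnOf (p t) = u t from hpu t ht]

end Translation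

/-- Uniform convergence on [0,T] is norm convergence in L^∞(0,T; X), which every continuous
functional respects, including those outside the predual. -/
lemma weaklyConvergesLinfty_of_tendstoUniformlyOn {X : Type*} [NormedAddCommGroup X]
    [NormedSpace ℝ X] {T : ℝ} {f : ℝ → ℝ → X} {g : ℝ → X}
    (hf : ∀ ε ∈ Ioc (0 : ℝ) 1, ContinuousOn (f ε) (Ici 0)) (hg : ContinuousOn g (Ici 0))
    (h : TendstoUniformlyOn f g (𝓝[>] 0) (Icc 0 T)) : WeaklyConvergesLinfty T f g := by
  classical
  have hmf : ∀ ε ∈ Ioc (0 : ℝ) 1, MemLp (f ε) ∞ (volume.restrict (Ioo 0 T)) := fun ε hε =>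
    memLp_Ioo_of_continuousOn (hf ε hε) ∞ T
  have hmg : MemLp g ∞ (volume.restrict (Ioo 0 T)) := memLp_Ioo_of_continuousOn hg ∞ T
  let F : ℝ → Lp X ∞ (volume.restrict (Ioo 0 T)) := fun ε =>
    if hε : ε ∈ Ioc (0 : ℝ) 1 then (hmf ε hε).toLp else 0
  have hF : ∀ ε ∈ Ioc (0 : ℝ) 1, F ε =ᵐ[volume.restrict (Ioo 0 T)] f ε := by
    intro ε hε
    simp only [F, dif_pos hε]
    exact (hmf ε hε).coeFn_toLp
  refine ⟨F, hmg.toLp, hF, hmg.coeFn_toLp, fun ℓ => (ℓ.continuous.tendsto _).comp ?_⟩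
  rw [Metric.tendsto_nhds]
  intro δ hδ
  filter_upwards [Metric.tendstoUniformlyOn_iff.mp h (δ / 2) (by positivity),
    Ioc_mem_nhdsGT one_pos] with ε h1 hε
  rw [dist_eq_norm]
  have hae : ∀ᵐ t ∂(volume.restrict (Ioo 0 T)), ‖(F ε - hmg.toLp) t‖ ≤ δ / 2 := by
    filter_upwards [Lp.coeFn_sub (F ε) hmg.toLp, hF ε hε, hmg.coeFn_toLp,
      ae_restrict_mem measurableSet_Ioo] with t h3 h4 h5 ht
    rw [h3, Pi.sub_apply, h4, h5, ← dist_eq_norm, dist_comm]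
    exact (h1 t ⟨ht.1.le, ht.2.le⟩).le
  have h2 := Lp.norm_le_of_ae_bound (by positivity) hae
  simp only [ENNReal.toReal_top, inv_zero, Real.rpow_zero, one_mul] at h2
  linarith

lemma IsExchangeOp.smul {X Y : Type*} [MeasureSpace X] [MeasureSpace Y] {A : Set X} {B : Set Y}
    {k : X → Y → ℝ} {c₁ c₂ : ℝ} {L : L2 A × L2 B →L[ℝ] L2 A} (hL : IsExchangeOp k c₁ c₂ L)
    (r : ℝ) : IsExchangeOp k (r * c₁) (r * c₂) (r • L) := by
  intro u v
  rw [smul_apply]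
  filter_upwards [hL u v, Lp.coeFn_smul r (L (u, v))] with x h1 h2
  rw [h2, Pi.smul_apply, h1, smul_eq_mul, ← integral_const_mul]
  refine integral_congr_ae (Eventually.of_forall fun y => ?_)
  simp only []
  ring

/-- The transversal integral maps solutions of the intermediate problem on `Ω × (R₁ × R₂)` to
solutions of the problem on `Ω × R₁`. -/
lemma IsCoupledSolution.transversal {N₁ N₂ : ℕ} {Ω : Set (E N₁ × E N₂)} {R₁ : Set (E N₁)}
    {R₂ : Set (E N₂)} (hR₁ : Bornology.IsBounded R₁) (hR₂ : Bornology.IsBounded R₂)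
    {A : L2 Ω × L2 (R₁ ×ˢ R₂) →L[ℝ] L2 Ω × L2 (R₁ ×ˢ R₂)} {A' : L2 Ω × L2 R₁ →L[ℝ] L2 Ω × L2 R₁}
    (hA₁ : ∀ u v, (A (u, v)).1 = (A' (u, transversalIntegral hR₂ v)).1)
    (hA₂ : ∀ u v, transversalIntegral hR₂ (A (u, v)).2 = (A' (u, transversalIntegral hR₂ v)).2)
    {u₀ : L2 Ω} {v₀ : L2 (R₁ ×ˢ R₂)} {u : ℝ → L2 Ω} {v : ℝ → L2 (R₁ ×ˢ R₂)}
    (h : IsCoupledSolution (embed Ω) A u₀ v₀ u v) :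
    IsCoupledSolution (embed Ω) A' u₀ (transversalIntegral hR₂ v₀) u
      fun t => transversalIntegral hR₂ (v t) := by
  have hu := h.continuous_u
  have hv := h.continuous_v
  refine ⟨hu, (transversalL hR₁ hR₂).continuous.comp hv, ?_, fun t ht => ?_⟩
  · simp_rw [← hA₁]
    exact h.eq_u
  · simp_rw [← hA₂]
    have hc : Continuous fun s => (A (u s, v s)).2 := by fun_prop
    have h1 := (transversalL hR₁ hR₂).intervalIntegral_comp_comm
      (hc.intervalIntegrable (μ := volume) 0 t)
    have h2 := congrArg (transversalL hR₁ hR₂) (h.eq_v t ht)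
    rw [map_add, ← h1] at h2
    exact h2

end ThinDomain

end

/-! ### The theorem -/

open ThinDomain
theorem theorem1p1 {N₁ N₂ : ℕ}
    (Ω : Set (E N₁ × E N₂)) (R₁ : Set (E N₁)) (R₂ : Set (E N₂))
    (hΩo : IsOpen Ω) (hΩb : Bornology.IsBounded Ω)
    (hR₁o : IsOpen R₁) (hR₁b : Bornology.IsBounded R₁)
    (hR₂o : IsOpen R₂) (hR₂b : Bornology.IsBounded R₂)
    (J G : E N₁ × E N₂ → ℝ)
    (hJc : Continuous J) (hJ_nonneg : ∀ x, 0 ≤ J x) (hJ_zero : 0 < J 0)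
    (hJ_symm : ∀ x, J (-x) = J x) (hJi : Integrable J)
    (hGc : Continuous G) (hG_nonneg : ∀ x, 0 ≤ G x) (hG_ne : ∃ x, G x ≠ 0) (hGi : Integrable G)
    (u₀ : H1 Ω) (v₀ : L2 (R₁ ×ˢ R₂))
    (u : ℝ → ℝ → L2 Ω) (v : ℝ → ℝ → L2 (R₁ ×ˢ R₂))
    (hsol : ∀ ε ∈ Set.Ioc (0 : ℝ) 1,
      IsRescaledSolution J G Ω R₁ R₂ ε (fnOf u₀) v₀ (u ε) (v ε)) :
    ∃ (uStar : ℝ → H1 Ω) (vStar : ℝ → L2 (R₁ ×ˢ R₂)) (VStar : ℝ → L2 R₁),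
      ContinuousOn uStar (Set.Ici 0) ∧
      ContinuousOn VStar (Set.Ici 0) ∧
      (∀ t : ℝ, 0 ≤ t → VStar t = transversalIntegral hR₂b (vStar t)) ∧
      (∀ T : ℝ, 0 < T →
        WeaklyConvergesLinfty T u (fun t => fnOf (uStar t)) ∧
        WeaklyConvergesLinfty T v vStar ∧
        WeaklyConvergesLinfty T (fun ε t => transversalIntegral hR₂b (v ε t)) VStar) ∧
      IsLimitSolution J G Ω R₁ R₂ (fnOf u₀) (transversalIntegral hR₂b v₀)
        (fun t => fnOf (uStar t)) VStar ∧
      (∀ (w : ℝ → L2 Ω) (Z : ℝ → L2 R₁),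
        IsLimitSolution J G Ω R₁ R₂ (fnOf u₀) (transversalIntegral hR₂b v₀) w Z →
        ∀ t : ℝ, 0 ≤ t → w t = fnOf (uStar t) ∧ Z t = VStar t) := by
  have hRb : Bornology.IsBounded (R₁ ×ˢ R₂) := hR₁b.prod hR₂b
  have hΩm := hΩo.measurableSet
  have hR₁m := hR₁o.measurableSet
  have hR₂m := hR₂o.measurableSet
  have hRm : MeasurableSet (R₁ ×ˢ R₂) := hR₁m.prod hR₂m
  have : IsFiniteMeasure (volume.restrict Ω) :=
    isFiniteMeasure_restrict.mpr hΩb.measure_lt_top.ne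
  have : IsFiniteMeasure (volume.restrict R₁) :=
    isFiniteMeasure_restrict.mpr hR₁b.measure_lt_top.ne
  have : IsFiniteMeasure ((volume : Measure (E N₁ × E N₂)).restrict (R₁ ×ˢ R₂)) :=
    isFiniteMeasure_restrict.mpr hRb.measure_lt_top.ne
  have hι := norm_embed_le (Ω := Ω)
  have hinj := embed_injective hΩo hΩb
  have hd := denseRange_embed hΩo hΩb
  -- the rescaled kernels and operators
  let k₁ : ℝ → E N₁ × E N₂ → E N₁ × E N₂ → ℝ := fun ε x y => G (x.1 - y.1, x.2 - ε • y.2)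
  let k₂ : ℝ → E N₁ × E N₂ → E N₁ × E N₂ → ℝ := fun ε x y => J (x.1 - y.1, ε • (x.2 - y.2))
  let k₃ : ℝ → E N₁ × E N₂ → E N₁ × E N₂ → ℝ := fun ε x y => G (x.1 - y.1, ε • x.2 - y.2)
  have hk₁c : Continuous fun p : ℝ × (E N₁ × E N₂) × (E N₁ × E N₂) => k₁ p.1 p.2.1 p.2.2 :=
    hGc.comp (by fun_prop)
  have hk₂c : Continuous fun p : ℝ × (E N₁ × E N₂) × (E N₁ × E N₂) => k₂ p.1 p.2.1 p.2.2 :=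
    hJc.comp (by fun_prop)
  have hk₃c : Continuous fun p : ℝ × (E N₁ × E N₂) × (E N₁ × E N₂) => k₃ p.1 p.2.1 p.2.2 :=
    hGc.comp (by fun_prop)
  choose M₁ hk₁ using fun ε => exists_isBoundedKernel hΩb hRb (k := k₁ ε)
    (hk₁c.comp (continuous_const.prodMk continuous_id))
  choose M₂ hk₂ using fun ε => exists_isBoundedKernel hRb hRb (k := k₂ ε)
    (hk₂c.comp (continuous_const.prodMk continuous_id))
  choose M₃ hk₃ using fun ε => exists_isBoundedKernel hRb hΩb (k := k₃ ε)
    (hk₃c.comp (continuous_const.prodMk continuous_id))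
  choose L₁ hL₁ using fun ε => exists_isExchangeOp (hk₁ ε) hΩm hRm 1 1
  choose L₂ hL₂ using fun ε => exists_isExchangeOp (hk₂ ε) hRm hRm 1 1
  choose L₃ hL₃ using fun ε => exists_isExchangeOp (hk₃ ε) hRm hΩm 1 1
  -- The kernels are defined for every real ε, so the limit operator is simply the one at ε = 0,
  -- still acting on functions on R₁ × R₂.
  have hA := tendsto_couplingOp 1
    (tendsto_exchangeOp hΩm hRm hk₁ (hk₁ 0)
      (fun δ hδ => eventually_abs_kernel_sub_le hΩb hRb hk₁c hδ) hL₁ (hL₁ 0))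
    (tendsto_exchangeOp hRm hRm hk₂ (hk₂ 0)
      (fun δ hδ => eventually_abs_kernel_sub_le hRb hRb hk₂c hδ) hL₂ (hL₂ 0))
    (tendsto_exchangeOp hRm hΩm hk₃ (hk₃ 0)
      (fun δ hδ => eventually_abs_kernel_sub_le hRb hΩb hk₃c hδ) hL₃ (hL₃ 0))
  have hcoupled : ∀ ε ∈ Ioc (0 : ℝ) 1, IsCoupledSolution (embed Ω)
      (couplingOp 1 (L₁ ε) (L₂ ε) (L₃ ε)) (fnOf u₀) v₀ (fun t => u ε (max t 0))
      (fun t => v ε (max t 0)) := fun ε hε =>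
    (hsol ε hε).isCoupledSolution (hL₁ ε) (hL₂ ε) (hL₃ ε)
      (continuous_comp_max_zero (hsol ε hε).continuousOn_u)
      (continuous_comp_max_zero (hsol ε hε).continuousOn_v)
      (fun t ht => by rw [max_eq_left ht]) (fun t ht => by rw [max_eq_left ht])
  obtain ⟨U, W, hUW, hunif⟩ := exists_limit_coupledSolution hι hinj hd hA hcoupled
  have hunif' : ∀ T, TendstoUniformlyOn (fun ε t => (u ε t, v ε t)) (fun t => (U t, W t))
      (𝓝[>] 0) (Icc 0 T) := fun T =>
    (hunif T).congr (Eventually.of_forall fun ε t ht => by simp only [max_eq_left ht.1])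
  -- the limit operators
  set c := volume.real R₂ with hc
  let j₁ : E N₁ × E N₂ → E N₁ → ℝ := fun x y₁ => G (x.1 - y₁, x.2 - 0)
  let j₂ : E N₁ → E N₁ → ℝ := fun x₁ y₁ => J (x₁ - y₁, 0)
  let j₃ : E N₁ → E N₁ × E N₂ → ℝ := fun x₁ y => G (x₁ - y.1, 0 - y.2)
  obtain ⟨m₁, hj₁⟩ := exists_isBoundedKernel hΩb hR₁b (k := j₁) (hGc.comp (by fun_prop))
  obtain ⟨m₂, hj₂⟩ := exists_isBoundedKernel hR₁b hR₁b (k := j₂) (hJc.comp (by fun_prop))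
  obtain ⟨m₃, hj₃⟩ := exists_isBoundedKernel hR₁b hΩb (k := j₃) (hGc.comp (by fun_prop))
  obtain ⟨P₁, hP₁⟩ := exists_isExchangeOp hj₁ hΩm hR₁m 1 c
  obtain ⟨P₂, hP₂⟩ := exists_isExchangeOp hj₂ hR₁m hR₁m 1 1
  obtain ⟨P₃, hP₃⟩ := exists_isExchangeOp hj₃ hR₁m hΩm c 1
  -- For J both variables lie in R, so the reduction takes two steps: j₄ is the kernel after the
  -- outer variable has been integrated over R₂, while the inner one still ranges over R₁ × R₂.
  let j₄ : E N₁ → E N₁ × E N₂ → ℝ := fun x₁ y => j₂ x₁ y.1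
  obtain ⟨m₄, hj₄⟩ := exists_isBoundedKernel hR₁b hRb (k := j₄) (hJc.comp (by fun_prop))
  obtain ⟨P₄, hP₄⟩ := exists_isExchangeOp hj₄ hR₁m hRm (c * 1) 1
  have e₁ : k₁ 0 = fun x y => j₁ x y.1 := by
    funext x y; simp only [k₁, j₁, zero_smul]
  have e₂ : k₂ 0 = fun x y => j₄ x.1 y := by
    funext x y; simp only [k₂, j₄, j₂, zero_smul]
  have e₃ : k₃ 0 = fun x y => j₃ x.1 y := by
    funext x y; simp only [k₃, j₃, zero_smul]
  have hT₁ : ∀ a b, L₁ 0 (a, b) = P₁ (a, transversalIntegral hR₂b b) := by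
    refine IsExchangeOp.apply_transversal_right hΩm hR₁m hR₂m hR₁b hR₂b hj₁ (c₁ := 1) (c₂ := 1)
      ?_ ?_
    · rw [← e₁]; exact hL₁ 0
    · rw [mul_one]; exact hP₁
  have hT₂ : ∀ b, transversalIntegral hR₂b (L₂ 0 (b, b))
      = c • P₂ (transversalIntegral hR₂b b, transversalIntegral hR₂b b) := by
    intro b
    have h1 : transversalIntegral hR₂b (L₂ 0 (b, b)) = P₄ (transversalIntegral hR₂b b, b) :=
      IsExchangeOp.transversal_apply hRm hR₁m hR₁b hR₂b hj₄ (by rw [← e₂]; exact hL₂ 0) hP₄ b b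
    -- The outer integration produced the factor |R₂| on the gain term and the inner one produces it
    -- on the loss term; together they give the factor c in front of the limit operator.
    have h2 : P₄ (transversalIntegral hR₂b b, b)
        = (c • P₂) (transversalIntegral hR₂b b, transversalIntegral hR₂b b) :=
      IsExchangeOp.apply_transversal_right hR₁m hR₁m hR₂m hR₁b hR₂b hj₂ hP₄ (hP₂.smul c) _ _
    rw [h1, h2]
    rfl
  have hT₃ : ∀ a b, transversalIntegral hR₂b (L₃ 0 (b, a))
      = P₃ (transversalIntegral hR₂b b, a) := fun a b =>
    IsExchangeOp.transversal_apply hΩm hR₁m hR₁b hR₂b hj₃ (by rw [← e₃]; exact hL₃ 0)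
      (by rw [mul_one]; exact hP₃) b a
  have hlim : IsCoupledSolution (embed Ω) (couplingOp c P₁ P₂ P₃) (fnOf u₀)
      (transversalIntegral hR₂b v₀) U fun t => transversalIntegral hR₂b (W t) := by
    refine hUW.transversal hR₁b hR₂b (fun a b => hT₁ a b) fun a b => ?_
    rw [couplingOp_apply, couplingOp_apply, one_smul, ← hT₂, ← hT₃]
    exact (transversalL hR₁b hR₂b).map_add _ _
  -- Here u₀ ∈ H¹(Ω) is essential: it yields continuity in H¹ up to t = 0.
  obtain ⟨p, hpc, hpU⟩ := hUW.eq_u.exists_continuousOn_lift (w₀ := u₀) hι hinj hd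
    hUW.continuous_u ((couplingOp 1 (L₁ 0) (L₂ 0) (L₃ 0)).continuous.comp
      (hUW.continuous_u.prodMk hUW.continuous_v)).fst
  -- The initial value is read off from the convergence at t = 0, where all members of the family
  -- with ε ∈ (0,1] agree.
  have hU0 : U 0 = fnOf u₀ := by
    have h1 : ∀ᶠ ε in 𝓝[>] (0 : ℝ), u ε 0 = fnOf u₀ := by
      filter_upwards [Ioc_mem_nhdsGT one_pos] with ε hε using (hsol ε hε).initial_u
    have h2 := (hunif' 0).tendsto_at (left_mem_Icc.mpr le_rfl)
    exact tendsto_nhds_unique_of_eventuallyEq ((continuous_fst.tendsto _).comp h2)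
      tendsto_const_nhds h1
  have hfc : ContinuousOn (fun t => fnOf (p t)) (Ici 0) :=
    (embed Ω).continuous.comp_continuousOn hpc
  have hVc : Continuous fun t => transversalIntegral hR₂b (W t) := hlim.continuous_v
  refine ⟨p, W, fun t => transversalIntegral hR₂b (W t), hpc, hVc.continuousOn, fun _ _ => rfl,
    fun T _ => ⟨?_, ?_, ?_⟩, hlim.isWeakSolution hinj hP₁ hP₂ hP₃ hU0 hpc hpU, ?_⟩
  · refine weaklyConvergesLinfty_of_tendstoUniformlyOn (fun ε hε => (hsol ε hε).continuousOn_u)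
      hfc ?_
    exact (uniformContinuous_fst.comp_tendstoUniformlyOn (hunif' T)).congr_right
      fun t ht => (hpU t ht.1).symm
  · exact weaklyConvergesLinfty_of_tendstoUniformlyOn (fun ε hε => (hsol ε hε).continuousOn_v)
      hUW.continuous_v.continuousOn (uniformContinuous_snd.comp_tendstoUniformlyOn (hunif' T))
  · exact weaklyConvergesLinfty_of_tendstoUniformlyOn
      (fun ε hε => (transversalL hR₁b hR₂b).continuous.comp_continuousOn
        (hsol ε hε).continuousOn_v) hVc.continuousOn
      ((transversalL hR₁b hR₂b).uniformContinuous.comp_tendstoUniformlyOn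
        (uniformContinuous_snd.comp_tendstoUniformlyOn (hunif' T)))
  · intro w Z hwZ t ht
    have h1 := hwZ.isCoupledSolution hP₁ hP₂ hP₃ (continuous_comp_max_zero hwZ.continuousOn_u)
      (continuous_comp_max_zero hwZ.continuousOn_v) (fun t ht => by rw [max_eq_left ht])
      (fun t ht => by rw [max_eq_left ht])
    have h2 := h1.unique hι hinj hd hlim ht
    simp only [max_eq_left ht] at h2
    exact ⟨h2.1.trans (hpU t ht).symm, h2.2⟩
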